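/- A \emph{theta-subgraph} of a multigraph $G$ consists of two distinct vertices $u,v$ and three different paths from $u$ to $v$ that pairwise share only the vertices $u$ and $v$. A \emph{linear class} of $G$ is a set $\mathcal{B}$ of cycles of $G$ such that no theta-subgraph contains exactly two members of $\mathcal{B}$; cycles in $\mathcal{B}$ are \emph{balanced}, all other cycles are \emph{unbalanced}. The \emph{lift matroid} $L(G,\mathcal{B})$ is the matroid on the edge set of $G$ whose circuits are the edge sets of: balanced cycles; theta-subgraphs containing no balanced cycle; and pairs of distinct unbalanced cycles with at most one common vertex. For $r\ge 3$ let $\Delta_r$ be the graph obtained from a cycle with $r$ edges by replacing each edge with a parallel pair. A \emph{spike} is a matroid isomorphic to $L(\Delta_r,\mathcal{B})$ for some $r\ge 3$ and some linear class $\mathcal{B}$ of Hamiltonian cycles of $\Delta_r$. For $k\ge 0$ let $\mathcal{S}_k$ be the class of matroids isomorphic to minors of matroids $L(\Delta_r,\mathcal{B})$, where $r\ge 3$ and $\mathcal{B}$ is a linear class of at most $k$ Hamiltonian cycles of $\Delta_r$. An \emph{excluded minor} for $\mathcal{S}_k$ is a matroid that is not in $\mathcal{S}_k$ but all of whose proper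 minors are in $\mathcal{S}_k$. A \emph{circuit-hyperplane} of a matroid is a circuit that is also a hyperplane. \textbf{Lemma.} Let $k\ge 2$ be an integer. There are a real number $c>0$ and an integer $T$, depending only on $k$, such that for every integer $t\ge T$ the number of isomorphism classes of $2t$-element excluded minors for $\mathcal{S}_k$ is at least $c\,t^{2^k-k-3}$. Moreover, this lower bound already holds for the number of isomorphism classes of those $2t$-element excluded minors for $\mathcal{S}_k$ that are spikes with exactly $k+1$ circuit-hyperplanes such that every element lies in at least one of these circuit-hyperplanes and avoids at least one of them. -/

import Mathlib

namespace Spikes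

/-! ### Cycles and theta-subgraphs of multigraphs, recorded by their edge sets -/

/-- The vertices incident with an edge in `X`. -/
def vertexSpan {V E : Type*} (G : Graph V E) (X : Set E) : Set V :=
  {v | ∃ e ∈ X, G.Inc e v}

/-- `C` is the edge set of a cycle of `G`: there are distinct vertices `x 0, …, x n` and distinct
edges `e 0, …, e n` such that `e i` joins `x i` to `x (i + 1)`, indices being read modulo `n + 1`.
Loops (`n = 0`) and parallel pairs (`n = 1`) are cycles. -/
def IsCycle {V E : Type*} (G : Graph V E) (C : Set E) : Prop :=
  ∃ (n : ℕ) (x : Fin (n + 1) → V) (e : Fin (n + 1) → E),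
    Function.Injective x ∧ Function.Injective e ∧
      (∀ i, G.IsLink (e i) (x i) (x (i + 1))) ∧ C = Set.range e

/-- `P` is the edge set, and `W` is the vertex set, of a path of `G` from `u` to `v`. -/
def IsPath {V E : Type*} (G : Graph V E) (u v : V) (W : Set V) (P : Set E) : Prop :=
  ∃ (n : ℕ) (x : Fin (n + 1) → V) (e : Fin n → E),
    Function.Injective x ∧ (∀ i : Fin n, G.IsLink (e i) (x i.castSucc) (x i.succ)) ∧
      x 0 = u ∧ x (Fin.last n) = v ∧ W = Set.range x ∧ P = Set.range e

/-- `X` is the edge set of a theta-subgraph of `G`: two distinct vertices `u` and `v`, with three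
different paths from `u` to `v` that pairwise share no vertices except `u` and `v`
(and no edges). -/
def IsTheta {V E : Type*} (G : Graph V E) (X : Set E) : Prop :=
  ∃ (u v : V) (W : Fin 3 → Set V) (P : Fin 3 → Set E), u ≠ v ∧
    (∀ i, IsPath G u v (W i) (P i)) ∧
    (∀ i j, i ≠ j → W i ∩ W j = {u, v} ∧ Disjoint (P i) (P j)) ∧
    X = ⋃ i, P i

/-- `C` is the edge set of a Hamiltonian cycle of `G`. -/
def IsHamiltonianCycle {V E : Type*} (G : Graph V E) (C : Set E) : Prop :=
  IsCycle G C ∧ vertexSpan G C = G.vertexSet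

/-- `B` is a linear class of cycles of `G`, that is, `(G, B)` is a biased graph: no theta-subgraph
contains exactly two members of `B`. -/
def IsLinearClass {V E : Type*} (G : Graph V E) (B : Set (Set E)) : Prop :=
  (∀ C ∈ B, IsCycle G C) ∧ ∀ X, IsTheta G X → {C | C ∈ B ∧ C ⊆ X}.ncard ≠ 2

/-! ### Lift matroids -/

/-- The circuits of the lift matroid of `(G, B)`: balanced cycles, theta-subgraphs with no balanced
cycle, and pairs of unbalanced cycles with at most one common vertex. -/
def IsLiftCircuit {V E : Type*} (G : Graph V E) (B : Set (Set E)) (X : Set E) : Prop :=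
  (IsCycle G X ∧ X ∈ B) ∨
  (IsTheta G X ∧ ∀ C, IsCycle G C → C ⊆ X → C ∉ B) ∨
  (∃ C D, IsCycle G C ∧ IsCycle G D ∧ C ∉ B ∧ D ∉ B ∧ C ≠ D ∧
    (vertexSpan G C ∩ vertexSpan G D).Subsingleton ∧ X = C ∪ D)

/-- `L` is the lift matroid `L(G, B)`: the matroid on the edges of `G` with the circuits above. -/
def IsLiftMatroid {V E : Type*} (G : Graph V E) (B : Set (Set E)) (L : Matroid E) : Prop :=
  L.E = G.edgeSet ∧ ∀ X, L.IsCircuit X ↔ IsLiftCircuit G B X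

/-- The lift matroid of a biased graph is determined by the biased graph. -/
theorem IsLiftMatroid.unique {V E : Type*} {G : Graph V E} {B : Set (Set E)} {L L' : Matroid E}
    (h : IsLiftMatroid G B L) (h' : IsLiftMatroid G B L') : L = L' :=
  Matroid.ext_isCircuit (h.1.trans h'.1.symm) fun X _ => (h.2 X).trans (h'.2 X).symm

/-! ### Isomorphism of matroids -/

/-- `M` and `N` are isomorphic: a bijection between the ground sets preserves independence. -/
def IsIso {α β : Type*} (M : Matroid α) (N : Matroid β) : Prop :=
  ∃ f : M.E ≃ N.E, ∀ I : Set M.E,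
    M.Indep (Subtype.val '' I) ↔ N.Indep (Subtype.val '' (f '' I))

theorem IsIso.refl {α : Type*} (M : Matroid α) : IsIso M M :=
  ⟨Equiv.refl _, fun I => by simp⟩

theorem IsIso.symm {α β : Type*} {M : Matroid α} {N : Matroid β} (h : IsIso M N) : IsIso N M := by
  obtain ⟨f, hf⟩ := h
  refine ⟨f.symm, fun I => ?_⟩
  have h1 := hf (f.symm '' I)
  rw [Equiv.image_symm_image] at h1
  exact h1.symm

theorem IsIso.trans {α β γ : Type*} {M : Matroid α} {N : Matroid β} {K : Matroid γ}
    (h : IsIso M N) (h' : IsIso N K) : IsIso M K := by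
  obtain ⟨f, hf⟩ := h
  obtain ⟨g, hg⟩ := h'
  refine ⟨f.trans g, fun I => ?_⟩
  have h1 : (f.trans g) '' I = g '' (f '' I) := by
    rw [Set.image_image]
    rfl
  rw [hf, hg, h1]

/-- Isomorphism, as an equivalence relation on the matroids with ground set `Fin n`. -/
def isoSetoid (n : ℕ) : Setoid {M : Matroid (Fin n) // M.E = Set.univ} where
  r M N := IsIso M.1 N.1
  iseqv := ⟨fun M => IsIso.refl M.1, fun h => IsIso.symm h, fun h h' => IsIso.trans h h'⟩

/-- The number of isomorphism classes of `n`-element matroids with the (isomorphism-invariant)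
property `P`. -/
noncomputable def numIsoClasses (n : ℕ) (P : Matroid (Fin n) → Prop) : ℕ :=
  {q : Quotient (isoSetoid n) | ∃ M : {M : Matroid (Fin n) // M.E = Set.univ},
    P M.1 ∧ Quotient.mk (isoSetoid n) M = q}.ncard

/-! ### Spikes and their minors -/

/-- The graph obtained from a cycle with `r` edges by replacing each edge with a parallel pair
(meant for `r ≥ 3`): the two edges `(i, true)` and `(i, false)` join `i` and `i + 1`. -/
def doubledCycle (r : ℕ) : Graph (ZMod r) (ZMod r × Bool) where
  vertexSet := Set.univ
  IsLink e x y := (x = e.1 ∧ y = e.1 + 1) ∨ (x = e.1 + 1 ∧ y = e.1)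
  edgeSet := Set.univ
  isLink_symm := fun _ _ => ⟨fun _ _ h => h.elim (fun p => Or.inr ⟨p.2, p.1⟩)
    fun p => Or.inl ⟨p.2, p.1⟩⟩
  eq_or_eq_of_isLink_of_isLink := by grind
  edge_mem_iff_exists_isLink := fun e =>
    ⟨fun _ => ⟨e.1, e.1 + 1, Or.inl ⟨rfl, rfl⟩⟩, fun _ => Set.mem_univ e⟩
  left_mem_of_isLink := fun _ x _ _ => Set.mem_univ x

/-- `L` is the rank-`r` (tipless) spike given by `B`, a linear class of Hamiltonian cycles of the
doubled cycle. -/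
def IsSpikeWith (r : ℕ) (B : Set (Set (ZMod r × Bool))) (L : Matroid (ZMod r × Bool)) : Prop :=
  3 ≤ r ∧ IsLinearClass (doubledCycle r) B ∧
    (∀ C ∈ B, IsHamiltonianCycle (doubledCycle r) C) ∧ IsLiftMatroid (doubledCycle r) B L

/-- `M` is (isomorphic to) a spike. -/
def IsSpike {α : Type*} (M : Matroid α) : Prop :=
  ∃ (r : ℕ) (B : Set (Set (ZMod r × Bool))) (L : Matroid (ZMod r × Bool)),
    IsSpikeWith r B L ∧ IsIso M L

/-- `M` belongs to the class `S_k`: it is isomorphic to a minor of a spike given by a linear class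
of at most `k` Hamiltonian cycles. -/
def InSpikeClass {α : Type*} (k : ℕ) (M : Matroid α) : Prop :=
  ∃ (r : ℕ) (B : Set (Set (ZMod r × Bool))) (L N : Matroid (ZMod r × Bool)),
    IsSpikeWith r B L ∧ B.encard ≤ k ∧ Matroid.IsMinor N L ∧ IsIso M N

/-- `M` is an excluded minor for `S_k`: it is not in `S_k`, but all its proper minors are. -/
def IsExcludedMinor {α : Type*} (k : ℕ) (M : Matroid α) : Prop :=
  ¬ InSpikeClass k M ∧ ∀ N : Matroid α, Matroid.IsStrictMinor N M → InSpikeClass k N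

/-! ### Circuit-hyperplanes -/

/-- `H` is a hyperplane of `M`: a maximal proper flat. -/
def IsHyperplane {α : Type*} (M : Matroid α) (H : Set α) : Prop :=
  Maximal (fun F => M.IsFlat F ∧ F ≠ M.E) H

/-- `C` is a circuit-hyperplane of `M`. -/
def IsCircuitHyperplane {α : Type*} (M : Matroid α) (C : Set α) : Prop :=
  M.IsCircuit C ∧ IsHyperplane M C

/-- `M` is a spike with exactly `m` circuit-hyperplanes, and every element of `M` lies in at least
one of them and avoids at least one of them. -/
def IsCoveredSpike {α : Type*} (m : ℕ) (M : Matroid α) : Prop :=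
  IsSpike M ∧ {C | IsCircuitHyperplane M C}.encard = m ∧
    ∀ x ∈ M.E, (∃ C, IsCircuitHyperplane M C ∧ x ∈ C) ∧ ∃ C, IsCircuitHyperplane M C ∧ x ∉ C

end Spikes

/-! In the doubled cycle with `r` legs (parallel pairs), every cycle is a leg or a transversal, and
every theta-subgraph is a transversal plus one element. So a linear class of Hamiltonian cycles is a
family `B` of transversals no two of which differ in exactly one leg, and its lift matroid has an
explicit description: a set is independent when it has at most one full leg, at most `r` elements,
and is not in `B` (`isLiftMatroid_spikeMatroid`, `IsSpikeWith.eq_spikeMatroid`).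

Deleting `x` makes the members of `B` through `x` irrelevant; contracting `x` does the same to the
members avoiding `x`. Hence if `B` has `k + 1` members and each element lies in one and avoids
another, every proper minor is a minor of a spike with at most `k` balanced Hamiltonian cycles. The
spike itself is not in `S_k`: a minor of a spike on `B'` having an independent set of size `t ≥ 5`
has at most `|B'|` circuits of size `t` (`encard_circuits_le_of_isMinor_spikeMatroid`), whereas a
rank-`t` spike on `B` has the members of `B` as circuits of size `t`. For `t ≥ 5` these members are
also exactly the circuit-hyperplanes.

To count such spikes, read `k + 1` transversals as the rows of a 0-1 matrix with columns indexed by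
the legs and zeroth row constantly 0; the column map `h` records the remaining `k` rows. Nonzero
columns give the covering condition, and each unit column occurring twice gives the separation
condition. The multiplicities of the `2^k - 2` nonconstant columns are prescribed freely, within a
range of length proportional to `t`, and all-ones columns fill the remaining legs. An isomorphism
permutes the `k + 1` rows, and this permutation together with the target determines the
multiplicities (`exists_perm_of_isIso`), so each isomorphism class arises at most `(k + 1)!` times.
This gives order `t^(2^k - 2)`, more than is asked. -/

namespace Spikes

/-! ### Spikes as matroids on the set of pairs `(leg, side)` -/

section SpikeMatroid

open Set

variable {ι : Type*}

/-- The legs with both elements in `X`. -/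
def fullLegs (X : Set (ι × Bool)) : Set ι := {i | ∀ b, (i, b) ∈ X}

/-- `C` contains exactly one element of each leg. -/
def IsTransversal (C : Set (ι × Bool)) : Prop := ∀ i, (i, true) ∈ C ↔ (i, false) ∉ C

/-- A family of transversals no two of which differ in exactly one leg. -/
structure IsSpikeFamily (B : Set (Set (ι × Bool))) : Prop where
  transversal : ∀ C ∈ B, IsTransversal C
  separated : ∀ C ∈ B, ∀ D ∈ B, ∀ i, (∀ x ∈ C, x.1 ≠ i → x ∈ D) → C = D

theorem IsSpikeFamily.subset {B B' : Set (Set (ι × Bool))} (hB : IsSpikeFamily B) (h : B' ⊆ B) :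
    IsSpikeFamily B' :=
  ⟨fun C hC => hB.transversal C (h hC), fun C hC D hD => hB.separated C (h hC) D (h hD)⟩

theorem mem_fullLegs {X : Set (ι × Bool)} {i : ι} :
    i ∈ fullLegs X ↔ (i, true) ∈ X ∧ (i, false) ∈ X := by
  simp [fullLegs, and_comm]

theorem fullLegs_mono {X Y : Set (ι × Bool)} (h : X ⊆ Y) : fullLegs X ⊆ fullLegs Y :=
  fun _ hi b => h (hi b)

theorem IsTransversal.fullLegs_eq {C : Set (ι × Bool)} (hC : IsTransversal C) :
    fullLegs C = ∅ := by
  ext i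
  simp only [mem_fullLegs, mem_empty_iff_false, iff_false, not_and]
  exact (hC i).1

theorem IsTransversal.fst_image {C : Set (ι × Bool)} (hC : IsTransversal C) :
    Prod.fst '' C = univ := by
  refine eq_univ_of_forall fun i => ?_
  by_cases h : (i, false) ∈ C
  · exact ⟨_, h, rfl⟩
  · exact ⟨_, (hC i).2 h, rfl⟩

theorem IsTransversal.eq_of_subset {C D : Set (ι × Bool)} (hC : IsTransversal C)
    (hD : IsTransversal D) (h : C ⊆ D) : C = D := by
  refine h.antisymm fun ⟨i, b⟩ hx => ?_
  have h1 := hC i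
  have h2 := hD i
  cases b
  · by_contra h3
    exact h2.1 (h (h1.2 h3)) hx
  · by_contra h3
    exact h2.1 hx (h (not_not.1 fun h4 => h3 (h1.2 h4)))

theorem isTransversal_of_fst_image {C : Set (ι × Bool)} (h1 : Prod.fst '' C = univ)
    (h2 : fullLegs C = ∅) : IsTransversal C := by
  intro i
  have h3 : i ∉ fullLegs C := by simp [h2]
  rw [mem_fullLegs, not_and] at h3
  refine ⟨h3, fun h4 => ?_⟩
  obtain ⟨⟨j, b⟩, hj, rfl⟩ : i ∈ Prod.fst '' C := by simp [h1]
  cases b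
  · exact absurd hj h4
  · exact hj

theorem IsTransversal.eq_of_mem {C : Set (ι × Bool)} (hC : IsTransversal C) {x y : ι × Bool}
    (hx : x ∈ C) (hy : y ∈ C) (h : x.1 = y.1) : x = y := by
  obtain ⟨i, b⟩ := x
  obtain ⟨j, c⟩ := y
  obtain rfl : i = j := h
  have := hC i
  cases b <;> cases c <;> simp_all

theorem IsTransversal.exists_mem {C : Set (ι × Bool)} (hC : IsTransversal C) (i : ι) :
    ∃ b, (i, b) ∈ C := by
  by_cases h : (i, false) ∈ C
  · exact ⟨_, h⟩
  · exact ⟨_, (hC i).2 h⟩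

/-- Independence in the spike in which exactly the transversals in `B` are balanced. -/
def SpikeIndep (B : Set (Set (ι × Bool))) (I : Set (ι × Bool)) : Prop :=
  (fullLegs I).Subsingleton ∧ I.ncard ≤ Nat.card ι ∧ I ∉ B

/-- The circuits of a spike. -/
def IsSpikeCircuit (B : Set (Set (ι × Bool))) (X : Set (ι × Bool)) : Prop :=
  X ∈ B ∨ (X.ncard = Nat.card ι + 1 ∧ (fullLegs X).Subsingleton ∧ ∀ C ∈ B, ¬ C ⊆ X) ∨
    ∃ i j, i ≠ j ∧ X = {x | x.1 = i ∨ x.1 = j}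

theorem fullLegs_insert_subset {I : Set (ι × Bool)} {e : ι × Bool} :
    fullLegs (insert e I) ⊆ insert e.1 (fullLegs I) := by
  intro i hi
  by_cases h : i = e.1
  · exact Or.inl h
  · refine Or.inr fun b => ?_
    rcases hi b with h' | h'
    · exact absurd (congrArg Prod.fst h') h
    · exact h'

theorem ncard_insert_le_card {I : Set (ι × Bool)} {e : ι × Bool} (h : I.ncard < Nat.card ι) :
    (insert e I).ncard ≤ Nat.card ι :=
  (ncard_insert_le e I).trans h

theorem fst_image_two_legs (i j : ι) : Prod.fst '' {x : ι × Bool | x.1 = i ∨ x.1 = j} = {i, j} := by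
  ext l
  simp

theorem fullLegs_two_legs (i j : ι) : fullLegs {x : ι × Bool | x.1 = i ∨ x.1 = j} = {i, j} := by
  ext l
  simp [fullLegs]

theorem IsSpikeCircuit.not_spikeIndep {B : Set (Set (ι × Bool))} {X : Set (ι × Bool)}
    (h : IsSpikeCircuit B X) : ¬ SpikeIndep B X := by
  rintro ⟨h1, h2, h3⟩
  rcases h with h | h | ⟨i, j, hij, rfl⟩
  · exact h3 h
  · omega
  · rw [fullLegs_two_legs] at h1
    exact hij (h1 (by simp) (by simp))

theorem fullLegs_insert_of_touched {X : Set (ι × Bool)} (x : ι × Bool) (hx : x ∉ X)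
    (h : x.1 ∈ Prod.fst '' X) : x.1 ∈ fullLegs (insert x X) := by
  obtain ⟨y, hy, hyx⟩ := h
  intro b
  by_cases hb : b = x.2
  · exact Or.inl (by rw [hb])
  · refine Or.inr ?_
    have hy2 : y.2 ≠ x.2 := fun h => hx ((Prod.ext hyx h : y = x) ▸ hy)
    have : y.2 = b := by
      revert hb hy2
      cases y.2 <;> cases x.2 <;> cases b <;> simp
    rw [← hyx, ← this]
    exact hy

/-! ### Counting elements by legs, and the matroid axioms -/

variable [Finite ι]

/-- Inclusion-exclusion for the legs whose `true` element lies in `X` and those whose `false`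
element does. -/
theorem ncard_eq_touched_add_full (X : Set (ι × Bool)) :
    X.ncard = (Prod.fst '' X).ncard + (fullLegs X).ncard := by
  have key : ∀ b, ((fun i => (i, b)) '' {i | (i, b) ∈ X} : Set (ι × Bool)).ncard =
      {i | (i, b) ∈ X}.ncard := fun b =>
    ncard_image_of_injective _ fun i j h => congrArg Prod.fst h
  have h1 : X = (fun i => (i, true)) '' {i | (i, true) ∈ X} ∪
      (fun i => (i, false)) '' {i | (i, false) ∈ X} := by
    ext ⟨i, b⟩
    cases b <;> simp
  have h2 : Prod.fst '' X = {i | (i, true) ∈ X} ∪ {i | (i, false) ∈ X} := by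
    ext i
    simp [or_comm]
  have h3 : fullLegs X = {i | (i, true) ∈ X} ∩ {i | (i, false) ∈ X} := by
    ext i
    exact mem_fullLegs
  rw [h2, h3, ncard_union_add_ncard_inter, ← key, ← key, ← ncard_union_eq, ← h1]
  rw [Set.disjoint_left]
  rintro _ ⟨i, _, rfl⟩ ⟨j, _, hj⟩
  simp at hj

theorem IsTransversal.ncard {C : Set (ι × Bool)} (hC : IsTransversal C) :
    C.ncard = Nat.card ι := by
  rw [ncard_eq_touched_add_full, hC.fullLegs_eq, hC.fst_image, ncard_univ, ncard_empty, add_zero]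

theorem isTransversal_of_ncard {C : Set (ι × Bool)} (h : C.ncard = Nat.card ι)
    (h' : fullLegs C = ∅) : IsTransversal C := by
  refine isTransversal_of_fst_image ?_ h'
  rw [ncard_eq_touched_add_full, h', ncard_empty, add_zero, ← ncard_univ] at h
  exact eq_of_subset_of_ncard_le (subset_univ _) h.ge

theorem touched_full_of_ncard {X : Set (ι × Bool)} (h1 : X.ncard = Nat.card ι + 1)
    (h2 : (fullLegs X).Subsingleton) : Prod.fst '' X = univ ∧ (fullLegs X).Nonempty := by
  have h3 := ncard_eq_touched_add_full X
  have h4 : (fullLegs X).ncard ≤ 1 := ncard_le_one_iff_subsingleton.2 h2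
  have h5 : (Prod.fst '' X).ncard ≤ Nat.card ι := by
    rw [← ncard_univ]
    exact ncard_le_ncard (subset_univ _)
  refine ⟨eq_of_subset_of_ncard_le (subset_univ _) ?_, nonempty_of_ncard_ne_zero (by omega)⟩
  rw [ncard_univ]
  omega

theorem SpikeIndep.subset {B : Set (Set (ι × Bool))} (hB : IsSpikeFamily B) {I J : Set (ι × Bool)}
    (hJ : SpikeIndep B J) (hIJ : I ⊆ J) : SpikeIndep B I := by
  refine ⟨hJ.1.anti (fullLegs_mono hIJ), (ncard_le_ncard hIJ).trans hJ.2.1, fun hI => ?_⟩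
  have : I = J := eq_of_subset_of_ncard_le hIJ (by
    rw [(hB.transversal I hI).ncard]; exact hJ.2.1)
  exact hJ.2.2 (this ▸ hI)

theorem SpikeIndep.augment {B : Set (Set (ι × Bool))} (hB : IsSpikeFamily B)
    {I J : Set (ι × Bool)} (hI : SpikeIndep B I) (hJ : SpikeIndep B J)
    (hIJ : I.ncard < J.ncard) : ∃ e ∈ J, e ∉ I ∧ SpikeIndep B (insert e I) := by
  have hcard : I.ncard < Nat.card ι := hIJ.trans_le hJ.2.1
  obtain ⟨e, heJ, heI⟩ := exists_mem_notMem_of_ncard_lt_ncard hIJ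
  rcases (fullLegs I).eq_empty_or_nonempty with h0 | ⟨i, hi⟩
  · have hfull : ∀ x, (fullLegs (insert x I)).Subsingleton := fun x =>
      (subsingleton_singleton (a := x.1)).anti
        (fullLegs_insert_subset.trans (by simp [h0]))
    -- Without a full leg in `I`, only membership in `B` can obstruct adding `e`. In that case
    -- another element `f` of `J` works, since `insert e I` and `insert f I` agree off one leg and
    -- cannot both be balanced.
    by_cases he : insert e I ∈ B
    swap
    · exact ⟨e, heJ, heI, hfull e, ncard_insert_le_card hcard, he⟩
    by_cases hsub : J ⊆ insert e I
    · have h1 : J = insert e I := eq_of_subset_of_ncard_le hsub (by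
        rw [ncard_insert_of_notMem heI]; exact hIJ)
      exact absurd (h1 ▸ he) hJ.2.2
    · obtain ⟨f, hfJ, hf⟩ := not_subset.1 hsub
      have hfI : f ∉ I := fun h => hf (mem_insert_of_mem _ h)
      refine ⟨f, hfJ, hfI, hfull f, ncard_insert_le_card hcard, fun hfB => ?_⟩
      have h1 : insert e I = insert f I := by
        refine hB.separated _ he _ hfB e.1 fun x hx hxe => ?_
        rcases hx with rfl | hx
        · exact absurd rfl hxe
        · exact mem_insert_of_mem _ hx
      exact hf (h1 ▸ mem_insert f I)
  · have hfi : ∀ j ∈ fullLegs I, j = i := fun j hj => hI.1 hj hi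
    have h1 : (fullLegs I).ncard = 1 := by
      rw [hI.1.eq_singleton_of_mem hi, ncard_singleton]
    have h2 : (fullLegs J).ncard ≤ 1 := ncard_le_one_iff_subsingleton.2 hJ.1
    -- `I` already has its one full leg, so the larger set `J` must touch more legs; an element in a
    -- new leg creates no second full leg.
    have h3 : (Prod.fst '' I).ncard < (Prod.fst '' J).ncard := by
      have := ncard_eq_touched_add_full I
      have := ncard_eq_touched_add_full J
      omega
    obtain ⟨_, ⟨f, hfJ, rfl⟩, hf⟩ := exists_mem_notMem_of_ncard_lt_ncard h3
    have hff : ∀ b, (f.1, b) ∉ I := fun b hb => hf ⟨_, hb, rfl⟩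
    refine ⟨f, hfJ, fun h => hff f.2 h, ?_, ncard_insert_le_card hcard, fun hfB => ?_⟩
    · have h4 : ∀ j ∈ fullLegs (insert f I), j = i := fun j hj => by
        rcases fullLegs_insert_subset hj with rfl | h
        · rcases hj (!f.2) with h5 | h5
          · exact absurd (congrArg Prod.snd h5) (by simp)
          · exact absurd h5 (hff _)
        · exact hfi j h
      exact fun a ha b hb => (h4 a ha).trans (h4 b hb).symm
    · have h4 := (hB.transversal _ hfB).fullLegs_eq
      exact (h4 ▸ fullLegs_mono (subset_insert f I) hi : i ∈ (∅ : Set ι))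

theorem ncard_two_legs {i j : ι} (h : i ≠ j) : {x : ι × Bool | x.1 = i ∨ x.1 = j}.ncard = 4 := by
  rw [ncard_eq_touched_add_full, fst_image_two_legs, fullLegs_two_legs, ncard_pair h]

theorem exists_isSpikeCircuit {B : Set (Set (ι × Bool))} {X : Set (ι × Bool)}
    (hX : ¬ SpikeIndep B X) :
    ∃ C ⊆ X, IsSpikeCircuit B C := by
  by_cases h1 : (fullLegs X).Subsingleton
  swap
  · rw [not_subsingleton_iff] at h1
    obtain ⟨i, hi, j, hj, hij⟩ := h1
    refine ⟨_, ?_, Or.inr (Or.inr ⟨i, j, hij, rfl⟩)⟩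
    rintro ⟨l, b⟩ (rfl | rfl)
    exacts [hi b, hj b]
  by_cases h2 : ∃ C ∈ B, C ⊆ X
  · obtain ⟨C, hC, hCX⟩ := h2
    exact ⟨C, hCX, Or.inl hC⟩
  push Not at h2
  refine ⟨X, Subset.rfl, Or.inr (Or.inl ⟨?_, h1, h2⟩)⟩
  have h3 : ¬ X.ncard ≤ Nat.card ι := fun h => hX ⟨h1, h, fun h' => h2 X h' Subset.rfl⟩
  have h4 : (fullLegs X).ncard ≤ 1 := ncard_le_one_iff_subsingleton.2 h1
  have h5 : (Prod.fst '' X).ncard ≤ Nat.card ι := by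
    rw [← ncard_univ]
    exact ncard_le_ncard (subset_univ _)
  have := ncard_eq_touched_add_full X
  omega

theorem IsSpikeCircuit.spikeIndep_of_ssubset {B : Set (Set (ι × Bool))}
    (hr : 3 ≤ Nat.card ι) (hB : IsSpikeFamily B) {C D : Set (ι × Bool)}
    (h : IsSpikeCircuit B C) (hD : D ⊂ C) : SpikeIndep B D := by
  have hlt : D.ncard < C.ncard := ncard_lt_ncard hD
  rcases h with h | ⟨h1, h2, h3⟩ | ⟨i, j, hij, rfl⟩
  · have hC := hB.transversal C h
    rw [hC.ncard] at hlt
    refine ⟨?_, hlt.le, fun h' => ?_⟩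
    · have := fullLegs_mono hD.subset
      rw [hC.fullLegs_eq] at this
      exact subsingleton_empty.anti this
    · have := (hB.transversal D h').ncard
      omega
  · exact ⟨h2.anti (fullLegs_mono hD.subset), by omega, fun h' => h3 D h' hD.subset⟩
  · rw [ncard_two_legs hij] at hlt
    refine ⟨?_, by omega, fun h' => ?_⟩
    · obtain ⟨x, hx, hxD⟩ := exists_of_ssubset hD
      have h1 := fullLegs_mono hD.subset
      rw [fullLegs_two_legs] at h1
      have h2 : x.1 ∉ fullLegs D := fun h => hxD (h x.2)
      intro a ha b hb
      have ha' := h1 ha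
      have hb' := h1 hb
      simp only [mem_insert_iff, mem_singleton_iff] at ha' hb'
      have hx' : x.1 = i ∨ x.1 = j := hx
      grind
    · have h1 := (hB.transversal D h').fst_image
      have h2 : (Prod.fst '' D).ncard ≤ 2 := by
        rw [← ncard_pair hij, ← fst_image_two_legs i j]
        exact ncard_le_ncard (image_mono hD.subset)
      rw [h1, ncard_univ] at h2
      omega

/-- The spike with legs indexed by `ι` in which exactly the transversals in `B` are balanced. -/
def spikeMatroid [Nonempty ι] (B : Set (Set (ι × Bool))) (hB : IsSpikeFamily B) :
    Matroid (ι × Bool) :=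
  (IndepMatroid.ofFinite (E := univ) finite_univ (SpikeIndep B)
    ⟨by
      rintro i hi
      simp [fullLegs] at hi, by simp, fun h => by
      simpa using hB.transversal _ h (Classical.arbitrary ι)⟩
    (fun _ _ hJ hIJ => hJ.subset hB hIJ)
    (fun _ _ hI hJ h => hI.augment hB hJ h)
    (fun _ _ => subset_univ _)).matroid

variable [Nonempty ι] {B : Set (Set (ι × Bool))} {hB : IsSpikeFamily B}

@[simp] theorem spikeMatroid_ground : (spikeMatroid B hB).E = univ := rfl

@[simp] theorem spikeMatroid_indep_iff {I : Set (ι × Bool)} :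
    (spikeMatroid B hB).Indep I ↔ SpikeIndep B I := Iff.rfl

theorem spikeMatroid_isCircuit_iff (hr : 3 ≤ Nat.card ι) {X : Set (ι × Bool)} :
    (spikeMatroid B hB).IsCircuit X ↔ IsSpikeCircuit B X := by
  have hdep : ∀ Y, (spikeMatroid B hB).Dep Y ↔ ¬ SpikeIndep B Y := fun Y => by
    simp [Matroid.Dep]
  refine ⟨fun h => ?_, fun h => ⟨(hdep X).2 (h.not_spikeIndep), fun D hD hDX => ?_⟩⟩
  · obtain ⟨C, hCX, hC⟩ := exists_isSpikeCircuit ((hdep X).1 h.1)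
    rwa [← hCX.antisymm (h.2 ((hdep C).2 (hC.not_spikeIndep)) hCX)]
  · by_contra hne
    exact (hdep D).1 hD (h.spikeIndep_of_ssubset hr hB ⟨hDX, hne⟩)

end SpikeMatroid

/-! ### Cycles and theta-subgraphs of the doubled cycle -/

section DoubledCycle

open Set

variable {r : ℕ}

theorem doubledCycle_isLink {e : ZMod r × Bool} {x y : ZMod r} :
    (doubledCycle r).IsLink e x y ↔ (x = e.1 ∧ y = e.1 + 1) ∨ (x = e.1 + 1 ∧ y = e.1) := Iff.rfl

theorem mem_vertexSpan_doubledCycle {X : Set (ZMod r × Bool)} {v : ZMod r} :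
    v ∈ vertexSpan (doubledCycle r) X ↔ ∃ e ∈ X, v = e.1 ∨ v = e.1 + 1 := by
  simp only [vertexSpan, Graph.Inc, doubledCycle_isLink, mem_ofPred_eq]
  refine exists_congr fun e => and_congr_right fun _ => ⟨?_, ?_⟩
  · rintro ⟨y, h | h⟩
    exacts [Or.inl h.1, Or.inr h.1]
  · rintro (h | h)
    exacts [⟨_, Or.inl ⟨h, rfl⟩⟩, ⟨_, Or.inr ⟨h, rfl⟩⟩]

theorem zmod_one_ne_zero (hr : 3 ≤ r) : (1 : ZMod r) ≠ 0 := by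
  intro h
  have := (ZMod.natCast_eq_zero_iff 1 r).1 (by exact_mod_cast h)
  have := Nat.le_of_dvd (by norm_num) this
  omega

theorem zmod_one_add_one_ne_zero (hr : 3 ≤ r) : (1 + 1 : ZMod r) ≠ 0 := by
  intro h
  have := (ZMod.natCast_eq_zero_iff 2 r).1 (by push_cast; rw [← h]; norm_num)
  have := Nat.le_of_dvd (by norm_num) this
  omega

theorem vertexSpan_leg (j : ZMod r) :
    vertexSpan (doubledCycle r) {x | x.1 = j} = {j, j + 1} := by
  ext v
  rw [mem_vertexSpan_doubledCycle]
  constructor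
  · rintro ⟨e, rfl, h⟩
    exact h
  · intro h
    exact ⟨(j, true), rfl, h⟩

theorem IsTransversal.vertexSpan {C : Set (ZMod r × Bool)} (hC : IsTransversal C) :
    vertexSpan (doubledCycle r) C = univ := by
  refine eq_univ_of_forall fun v => mem_vertexSpan_doubledCycle.2 ?_
  obtain ⟨b, hb⟩ := hC.exists_mem v
  exact ⟨_, hb, Or.inl rfl⟩

theorem isCycle_leg (hr : 3 ≤ r) (j : ZMod r) : IsCycle (doubledCycle r) {x | x.1 = j} := by
  refine ⟨1, ![j, j + 1], ![(j, true), (j, false)], ?_, ?_, ?_, ?_⟩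
  · intro a b h
    have := zmod_one_ne_zero hr
    fin_cases a <;> fin_cases b <;> simp_all
  · intro a b h
    fin_cases a <;> fin_cases b <;> simp_all
  · intro i
    fin_cases i
    · exact Or.inl ⟨rfl, rfl⟩
    · exact Or.inr ⟨rfl, rfl⟩
  · ext ⟨i, b⟩
    cases b <;> simp [eq_comm]

theorem IsTransversal.isCycle (hr : 3 ≤ r) {C : Set (ZMod r × Bool)} (hC : IsTransversal C) :
    IsCycle (doubledCycle r) C := by
  obtain ⟨n, rfl⟩ : ∃ n, r = n + 1 := ⟨r - 1, by omega⟩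
  choose s hs using hC.exists_mem
  refine ⟨n, fun i : ZMod (n + 1) => i, fun i : ZMod (n + 1) => (i, s i), fun _ _ h => h,
    fun a b h => congrArg Prod.fst h, fun i => Or.inl ⟨rfl, rfl⟩, ?_⟩
  ext ⟨i, b⟩
  constructor
  · intro h
    exact ⟨i, hC.eq_of_mem (hs i) h rfl⟩
  · rintro ⟨j, hj⟩
    rw [← hj]
    exact hs j

theorem mem_leg_of_ne {e f : ZMod r × Bool} (h : e.1 = f.1) (hne : e ≠ f) (g : ZMod r × Bool)
    (hg : g.1 = e.1) : g = e ∨ g = f := by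
  obtain ⟨i, a⟩ := e
  obtain ⟨j, b⟩ := f
  obtain ⟨k, c⟩ := g
  cases a <;> cases b <;> cases c <;> simp_all

theorem eq_univ_of_add_one_mem [NeZero r] {S : Set (ZMod r)} (hS : S.Nonempty)
    (h : ∀ j ∈ S, j + 1 ∈ S) : S = univ := by
  obtain ⟨a, ha⟩ := hS
  have key : ∀ m : ℕ, a + m ∈ S := by
    intro m
    induction m with
    | zero => simpa using ha
    | succ m ih =>
      have := h _ ih
      rwa [add_assoc, ← Nat.cast_succ] at this
  refine eq_univ_of_forall fun j => ?_
  have := key (j - a).val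
  rwa [ZMod.natCast_zmod_val, add_sub_cancel] at this

/-- Two cycle edges in one leg have the same ends, so the cycle closes up after two steps. Otherwise
each leg is used at most once, and at each vertex the cycle must pass on to the next leg, so it goes
all the way round. -/
theorem leg_or_transversal_of_isCycle (hr : 3 ≤ r) {C : Set (ZMod r × Bool)}
    (hC : IsCycle (doubledCycle r) C) : (∃ j, C = {x | x.1 = j}) ∨ IsTransversal C := by
  have : NeZero r := ⟨by omega⟩
  have h1 := zmod_one_ne_zero hr
  obtain ⟨n, x, e, hx, he, hl, rfl⟩ := hC
  simp only [doubledCycle_isLink] at hl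
  have hn : n ≠ 0 := by
    rintro rfl
    have h2 := hl 0
    rw [Subsingleton.elim ((0 : Fin 1) + 1) 0] at h2
    rcases h2 with ⟨h2, h3⟩ | ⟨h2, h3⟩ <;> exact h1 (by simpa using h2.symm.trans h3)
  by_cases hfull : ∃ a b, a ≠ b ∧ (e a).1 = (e b).1
  · obtain ⟨a, b, hab, h2⟩ := hfull
    have h3 : a = b + 1 ∧ a + 1 = b := by
      have ha := hl a
      have hb := hl b
      rw [← h2] at hb
      rcases ha with ha | ha <;> rcases hb with hb | hb
      · exact absurd (hx (ha.1.trans hb.1.symm)) hab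
      · exact ⟨hx (ha.1.trans hb.2.symm), hx (ha.2.trans hb.1.symm)⟩
      · exact ⟨hx (ha.1.trans hb.2.symm), hx (ha.2.trans hb.1.symm)⟩
      · exact absurd (hx (ha.1.trans hb.1.symm)) hab
    have hn1 : n = 1 := by
      have h4 : (1 + 1 : Fin (n + 1)) = 0 := by
        have := h3.1
        rw [← h3.2, add_assoc] at this
        simpa using this.symm
      by_contra hn1
      have h5 := congrArg Fin.val h4
      rw [Fin.val_add, Fin.val_one', Nat.mod_eq_of_lt (by omega : 1 < n + 1),
        Nat.mod_eq_of_lt (by omega : 1 + 1 < n + 1)] at h5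
      simp at h5
    subst hn1
    have hcov : ∀ a b c : Fin 2, a ≠ b → c = a ∨ c = b := by decide
    refine Or.inl ⟨(e a).1, ?_⟩
    ext g
    constructor
    · rintro ⟨c, rfl⟩
      rcases hcov a b c hab with rfl | rfl
      exacts [rfl, h2.symm]
    · intro hg
      rcases mem_leg_of_ne h2 (fun h => hab (he h)) g hg with rfl | rfl
      exacts [⟨a, rfl⟩, ⟨b, rfl⟩]
  · push Not at hfull
    refine Or.inr (isTransversal_of_fst_image ?_ ?_)
    · refine eq_univ_of_add_one_mem ⟨_, _, ⟨0, rfl⟩, rfl⟩ ?_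
      rintro _ ⟨_, ⟨i, rfl⟩, rfl⟩
      obtain ⟨a, ha⟩ : ∃ a, x a = (e i).1 + 1 := by
        rcases hl i with h | h
        exacts [⟨_, h.2⟩, ⟨_, h.1⟩]
      -- The cycle edges `e (a - 1)` and `e a` meet at the far end of the leg of `e i`. If neither
      -- were in the next leg, both would be in the leg of `e i`, which is excluded.
      have hne : a - 1 ≠ a := by
        intro h
        have h2 : (1 : Fin (n + 1)) = 0 := by simpa using h
        have h3 := congrArg Fin.val h2
        rw [Fin.val_one', Fin.val_zero, Nat.mod_eq_of_lt (by omega)] at h3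
        omega
      have hl1 := hl a
      have hl2 := hl (a - 1)
      rw [sub_add_cancel] at hl2
      rw [ha] at hl1 hl2
      by_contra hcon
      have hcon' : ∀ c, (e c).1 ≠ (e i).1 + 1 := fun c hc => hcon ⟨_, ⟨c, rfl⟩, hc⟩
      have e1 : (e a).1 = (e i).1 := by
        rcases hl1 with h | h
        exacts [absurd h.1.symm (hcon' _), (add_right_cancel h.1).symm]
      have e2 : (e (a - 1)).1 = (e i).1 := by
        rcases hl2 with h | h
        exacts [(add_right_cancel h.2).symm, absurd h.2.symm (hcon' _)]
      exact hfull _ _ hne (e2.trans e1.symm)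
    · ext j
      rw [mem_fullLegs]
      simp only [mem_empty_iff_false, iff_false]
      rintro ⟨⟨a, ha⟩, ⟨b, hb⟩⟩
      refine hfull a b ?_ (by rw [ha, hb])
      rintro rfl
      rw [ha] at hb
      simp at hb

/-! ### Paths and theta-subgraphs -/

theorem IsPath.insert_isCycle {u v : ZMod r} {W : Set (ZMod r)} {P : Set (ZMod r × Bool)}
    (hP : IsPath (doubledCycle r) u v W P) {f : ZMod r × Bool}
    (hf : (doubledCycle r).IsLink f v u) (hfP : f ∉ P) :
    IsCycle (doubledCycle r) (insert f P) := by
  obtain ⟨n, x, e, hx, hl, h0, hlast, rfl, rfl⟩ := hP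
  -- A path is only required to have distinct vertices, while a cycle also needs distinct edges.
  have he : Function.Injective e := by
    intro a b hab
    have h1 := hl a
    rw [hab] at h1
    rcases h1.eq_and_eq_or_eq_and_eq (hl b) with h | h
    · exact Fin.castSucc_injective _ (hx h.1)
    · have h2 := congrArg Fin.val (hx h.1)
      have h3 := congrArg Fin.val (hx h.2)
      simp at h2 h3
      omega
  refine ⟨n, x, Fin.snoc (α := fun _ => ZMod r × Bool) e f, hx, ?_, ?_, ?_⟩
  · rw [Fin.snoc_injective_iff]
    exact ⟨he, hfP⟩
  · intro i
    refine Fin.lastCases ?_ (fun i => ?_) i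
    · rw [Fin.snoc_last, Fin.last_add_one, h0, hlast]
      exact hf
    · rw [Fin.snoc_castSucc, Fin.coeSucc_eq_succ]
      exact hl i
  · rw [Fin.range_snoc]

/-- Only two legs meet at `u`, so two of the three paths start in the same leg and share their
second vertex. That vertex must be `v`, so both paths are single edges. The third path together with
one of them is a cycle missing the other, hence a transversal. -/
theorem exists_transversal_of_isTheta (hr : 3 ≤ r) {X : Set (ZMod r × Bool)}
    (hX : IsTheta (doubledCycle r) X) :
    ∃ T e, IsTransversal T ∧ e ∉ T ∧ X = insert e T := by
  have h1 := zmod_one_ne_zero hr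
  obtain ⟨u, v, W, P, huv, hP, hWP, rfl⟩ := hX
  have hfirst : ∀ i, ∃ f ∈ P i, ∃ w ∈ W i, (doubledCycle r).IsLink f u w ∧ (w = v → P i = {f}) := by
    intro i
    obtain ⟨n, x, e, hx, hl, h0, hlast, hW, hPi⟩ := hP i
    rw [hW, hPi]
    cases n with
    | zero => exact absurd (h0.symm.trans hlast) huv
    | succ n =>
      refine ⟨e 0, ⟨0, rfl⟩, x 1, ⟨1, rfl⟩, ?_, fun h => ?_⟩
      · have := hl 0
        rwa [Fin.castSucc_zero, h0] at this
      · have h2 := congrArg Fin.val (hx (h.trans hlast.symm))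
        simp at h2
        subst h2
        simp [Set.range_unique]
  choose f hf w hw hl hv using hfirst
  have hpig : ∃ p q, p ≠ q ∧ (f p).1 = (f q).1 := by
    have hu : ∀ i, (f i).1 = u ∨ (f i).1 = u - 1 := fun i => by
      rcases hl i with h | h
      · exact Or.inl h.1.symm
      · right
        rw [h.1, add_sub_cancel_right]
    rcases hu 0 with a | a <;> rcases hu 1 with b | b <;> rcases hu 2 with c | c
    all_goals first
      | exact ⟨0, 1, by decide, a.trans b.symm⟩
      | exact ⟨0, 2, by decide, a.trans c.symm⟩
      | exact ⟨1, 2, by decide, b.trans c.symm⟩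
  obtain ⟨p, q, hpq, hleg⟩ := hpig
  have hlink : ∀ y z, (doubledCycle r).IsLink (f p) y z ↔ (doubledCycle r).IsLink (f q) y z := by
    intro y z
    rw [doubledCycle_isLink, doubledCycle_isLink, hleg]
  have hwpq : w p = w q := ((hlink _ _).1 (hl p)).right_unique (hl q)
  have hwu : w p ≠ u := by
    intro h
    have h2 := hl p
    rw [h] at h2
    rcases h2 with ⟨h2, h3⟩ | ⟨h2, h3⟩ <;> exact h1 (by simpa using h2.symm.trans h3)
  have hwv : w p = v := by
    have : w p ∈ W p ∩ W q := ⟨hw p, hwpq ▸ hw q⟩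
    rw [(hWP p q hpq).1] at this
    exact this.resolve_left hwu
  have hthird : ∀ p q : Fin 3, p ≠ q → ∃ s, s ≠ p ∧ s ≠ q ∧ ∀ i, i = p ∨ i = q ∨ i = s := by
    decide
  obtain ⟨s, hsp, hsq, hcov⟩ := hthird p q hpq
  have hfp : f p ∉ P s := disjoint_right.1 (hWP s p hsp).2 (hf p)
  have hfq : f q ∉ P s := disjoint_right.1 (hWP s q hsq).2 (hf q)
  have hne : f q ≠ f p := fun h => disjoint_left.1 (hWP p q hpq).2 (hf p) (h ▸ hf q)
  have hfqT : f q ∉ insert (f p) (P s) := fun h => h.elim hne hfq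
  refine ⟨insert (f p) (P s), f q, ?_, hfqT, ?_⟩
  · have hlp := (hl p).symm
    rw [hwv] at hlp
    refine (leg_or_transversal_of_isCycle hr ((hP s).insert_isCycle hlp hfp)).resolve_left ?_
    rintro ⟨j, hj⟩
    have h2 : f p ∈ {x : ZMod r × Bool | x.1 = j} := hj ▸ mem_insert _ _
    refine hfqT (hj ▸ ?_)
    exact hleg.symm.trans h2
  · have hp := hv p hwv
    have hq := hv q (hwpq ▸ hwv)
    ext y
    simp only [mem_iUnion, mem_insert_iff]
    constructor
    · rintro ⟨i, hi⟩
      rcases hcov i with rfl | rfl | rfl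
      · rw [hp] at hi
        exact Or.inr (Or.inl hi)
      · rw [hq] at hi
        exact Or.inl hi
      · exact Or.inr (Or.inr hi)
    · rintro (rfl | rfl | h)
      exacts [⟨q, hf q⟩, ⟨p, hf p⟩, ⟨s, h⟩]

theorem isPath_edge (hr : 3 ≤ r) (e : ZMod r × Bool) :
    IsPath (doubledCycle r) (e.1 + 1) e.1 {e.1 + 1, e.1} {e} := by
  refine ⟨1, ![e.1 + 1, e.1], ![e], ?_, ?_, rfl, rfl, by simp [pair_comm], by simp⟩
  · intro a b h
    have := zmod_one_ne_zero hr
    fin_cases a <;> fin_cases b <;> simp_all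
  · intro i
    fin_cases i
    exact Or.inr ⟨rfl, rfl⟩

theorem IsTransversal.isPath (hr : 3 ≤ r) {T : Set (ZMod r × Bool)} (hT : IsTransversal T)
    {e : ZMod r × Bool} (he : e ∈ T) :
    IsPath (doubledCycle r) (e.1 + 1) e.1 univ (T \ {e}) := by
  obtain ⟨m, rfl⟩ : ∃ m, r = m + 1 := ⟨r - 1, by omega⟩
  choose s hs using hT.exists_mem
  obtain ⟨j, b⟩ := e
  -- Start at the far end of the leg of `e` and walk once round, ending at its near end.
  let y : Fin (m + 1) → ZMod (m + 1) := fun i => j + 1 + (i.val : ZMod (m + 1))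
  have hlast : y (Fin.last m) = j := by
    have : (1 + m : ZMod (m + 1)) = 0 := by
      have h := ZMod.natCast_self (m + 1)
      push_cast at h
      rwa [add_comm (1 : ZMod (m + 1))]
    simp only [y, Fin.val_last, add_assoc, this, add_zero]
  have hy : Function.Injective y := fun a b h => by
    have h2 := (ZMod.natCast_eq_natCast_iff' _ _ _).1 (add_left_cancel h)
    rwa [Nat.mod_eq_of_lt a.2, Nat.mod_eq_of_lt b.2, Fin.val_inj] at h2
  have hsurj : ∀ v, ∃ i, y i = v := fun v => by
    refine ⟨⟨(v - (j + 1)).val, ZMod.val_lt _⟩, ?_⟩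
    simp only [y, ZMod.natCast_zmod_val, add_sub_cancel]
  refine ⟨m, y, fun i => (y i.castSucc, s (y i.castSucc)), hy, fun i => Or.inl ⟨rfl, ?_⟩, ?_, hlast,
    (eq_univ_of_forall hsurj).symm, ?_⟩
  · simp only [y, Fin.val_succ, Fin.val_castSucc, Nat.cast_add, Nat.cast_one, add_assoc]
  · simp [y]
  · ext ⟨l, c⟩
    constructor
    · rintro ⟨hl, hne⟩
      have hlj : l ≠ j := fun h => hne (hT.eq_of_mem hl he h)
      obtain ⟨i, hi⟩ : ∃ i, y i = l := hsurj l
      induction i using Fin.lastCases with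
      | last => exact absurd (hi.symm.trans hlast) hlj
      | cast i =>
        subst hi
        exact ⟨i, hT.eq_of_mem (hs _) hl rfl⟩
    · rintro ⟨i, hi⟩
      rw [← hi]
      refine ⟨hs _, fun h => ?_⟩
      have h2 : y i.castSucc = y (Fin.last m) := (congrArg Prod.fst h).trans hlast.symm
      exact (Fin.castSucc_lt_last i).ne (hy h2)

theorem IsTransversal.isTheta_insert (hr : 3 ≤ r) {T : Set (ZMod r × Bool)}
    (hT : IsTransversal T) {e : ZMod r × Bool} (he : e ∉ T) :
    IsTheta (doubledCycle r) (insert e T) := by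
  have h1 := zmod_one_ne_zero hr
  obtain ⟨b, hb⟩ := hT.exists_mem e.1
  have hne : e ≠ (e.1, b) := fun h => he (h ▸ hb)
  refine ⟨e.1 + 1, e.1, ![{e.1 + 1, e.1}, {e.1 + 1, e.1}, univ],
    ![{e}, {(e.1, b)}, T \ {(e.1, b)}], by simpa using h1, ?_, ?_, ?_⟩
  · intro i
    fin_cases i
    exacts [isPath_edge hr e, isPath_edge hr (e.1, b), hT.isPath hr hb]
  · intro i j hij
    fin_cases i <;> fin_cases j <;> simp_all [eq_comm]
  · ext y
    simp only [mem_insert_iff, mem_iUnion, Fin.exists_fin_succ, IsEmpty.exists_iff, or_false,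
      Matrix.cons_val_zero, Matrix.cons_val_succ, mem_singleton_iff, mem_sdiff]
    by_cases h : y = (e.1, b)
    · subst h
      simp [hb]
    · simp [h]

theorem IsTransversal.eq_of_subset_insert {C D F : Set (ZMod r × Bool)} {e : ZMod r × Bool}
    (hC : IsTransversal C) (hD : IsTransversal D) (hF : IsTransversal F)
    (hDe : e ∈ D) (hFe : e ∈ F) (hDC : D ⊆ insert e C) (hFC : F ⊆ insert e C) : D = F := by
  refine hD.eq_of_subset hF fun y hy => ?_
  by_cases hye : y.1 = e.1
  · rwa [hD.eq_of_mem hy hDe hye]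
  obtain ⟨c, hc⟩ := hF.exists_mem y.1
  have h1 : y ∈ C := (hDC hy).resolve_left fun h => hye (h ▸ rfl)
  have h2 : (y.1, c) ∈ C := (hFC hc).resolve_left fun h => hye (by rw [← h])
  rwa [hC.eq_of_mem h1 h2 rfl]

theorem leg_not_hamiltonian (hr : 3 ≤ r) (j : ZMod r) : ({j, j + 1} : Set (ZMod r)) ≠ univ := by
  intro h
  have h1 : j + (1 + 1) ∈ ({j, j + 1} : Set (ZMod r)) := h ▸ mem_univ _
  rcases h1 with h1 | h1
  · exact zmod_one_add_one_ne_zero hr (by simpa using h1)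
  · rw [mem_singleton_iff, ← add_assoc] at h1
    exact zmod_one_ne_zero hr (by simpa using h1)

/-! ### Linear classes as separated families, and lift circuits as spike circuits -/

theorem isHamiltonianCycle_iff (hr : 3 ≤ r) {C : Set (ZMod r × Bool)} :
    IsHamiltonianCycle (doubledCycle r) C ↔ IsTransversal C := by
  refine ⟨fun h => ?_, fun h => ⟨h.isCycle hr, h.vertexSpan⟩⟩
  refine (leg_or_transversal_of_isCycle hr h.1).resolve_left ?_
  rintro ⟨j, rfl⟩
  have h2 := h.2
  rw [vertexSpan_leg] at h2
  exact leg_not_hamiltonian hr j h2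

theorem isSpikeFamily_of_isLinearClass (hr : 3 ≤ r) {B : Set (Set (ZMod r × Bool))}
    (hB : IsLinearClass (doubledCycle r) B) (hH : ∀ C ∈ B, IsHamiltonianCycle (doubledCycle r) C) :
    IsSpikeFamily B := by
  have htr : ∀ C ∈ B, IsTransversal C := fun C hC => (isHamiltonianCycle_iff hr).1 (hH C hC)
  refine ⟨htr, fun C hC D hD i h => by_contra fun hne => ?_⟩
  have hCt := htr C hC
  have hDt := htr D hD
  obtain ⟨e, heD, heC⟩ := not_subset.1 fun h' : D ⊆ C => hne (hDt.eq_of_subset hCt h').symm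
  have hei : e.1 = i := by
    by_contra hei
    obtain ⟨c, hc⟩ := hCt.exists_mem e.1
    have := hDt.eq_of_mem (h _ hc hei) heD rfl
    exact heC (this ▸ hc)
  have hDC : D ⊆ insert e C := fun y hy => by
    by_cases hye : y.1 = e.1
    · exact Or.inl (hDt.eq_of_mem hy heD hye)
    · obtain ⟨c, hc⟩ := hCt.exists_mem y.1
      have := hDt.eq_of_mem (h _ hc (hei ▸ hye)) hy rfl
      exact Or.inr (this ▸ hc)
  -- If `D` is `C` changed in the single leg of `e`, then `C` and `D` are the only transversals in
  -- the theta-subgraph `insert e C`: exactly two balanced cycles.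
  refine hB.2 _ (hCt.isTheta_insert hr heC) ?_
  have : {F | F ∈ B ∧ F ⊆ insert e C} = {C, D} := by
    ext F
    constructor
    · rintro ⟨hF, hFC⟩
      by_cases heF : e ∈ F
      · exact Or.inr (hCt.eq_of_subset_insert (htr F hF) hDt heF heD hFC hDC)
      · exact Or.inl ((htr F hF).eq_of_subset hCt ((subset_insert_iff_of_notMem heF).1 hFC))
    · rintro (rfl | rfl)
      exacts [⟨hC, subset_insert _ _⟩, ⟨hD, hDC⟩]
  rw [this, ncard_pair hne]

theorem IsSpikeFamily.isLinearClass (hr : 3 ≤ r) {B : Set (Set (ZMod r × Bool))}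
    (hB : IsSpikeFamily B) : IsLinearClass (doubledCycle r) B := by
  refine ⟨fun C hC => (hB.transversal C hC).isCycle hr, fun X hX => ?_⟩
  obtain ⟨T, e, hT, he, rfl⟩ := exists_transversal_of_isTheta hr hX
  have hsub : {C | C ∈ B ∧ C ⊆ insert e T}.Subsingleton := by
    rintro C ⟨hC, hCT⟩ D ⟨hD, hDT⟩
    refine hB.separated C hC D hD e.1 fun x hx hxe => ?_
    obtain ⟨c, hc⟩ := (hB.transversal D hD).exists_mem x.1
    have h1 : x ∈ T := (hCT hx).resolve_left fun h => hxe (h ▸ rfl)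
    have h2 : (x.1, c) ∈ T := (hDT hc).resolve_left fun h => hxe (by rw [← h])
    rwa [hT.eq_of_mem h1 h2 rfl]
  have := hsub.finite.to_subtype
  have := ncard_le_one_iff_subsingleton.2 hsub
  omega

theorem two_legs_eq_union (i j : ZMod r) :
    {x : ZMod r × Bool | x.1 = i ∨ x.1 = j} = {x | x.1 = i} ∪ {x | x.1 = j} := rfl

/-- A transversal meets every vertex, so two cycles with at most one common vertex are both legs;
conversely, as `r ≥ 3`, distinct legs share at most one vertex. The theta-subgraphs are the sets of
`r + 1` elements with a single full leg. -/
theorem isLiftCircuit_doubledCycle_iff (hr : 3 ≤ r) {B : Set (Set (ZMod r × Bool))}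
    (hB : IsSpikeFamily B) {X : Set (ZMod r × Bool)} :
    IsLiftCircuit (doubledCycle r) B X ↔ IsSpikeCircuit B X := by
  have : NeZero r := ⟨by omega⟩
  have h1 := zmod_one_ne_zero hr
  have hspan : ∀ C, IsCycle (doubledCycle r) C → ∃ j, {j, j + 1} ⊆ vertexSpan (doubledCycle r) C :=
    fun C hC => by
      rcases leg_or_transversal_of_isCycle hr hC with ⟨j, rfl⟩ | h
      · exact ⟨j, (vertexSpan_leg j).ge⟩
      · exact ⟨0, by simp [h.vertexSpan]⟩
  have hnot : ∀ j : ZMod r, ¬ ({j, j + 1} : Set (ZMod r)).Subsingleton := fun j h =>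
    h1 (by simpa using h (mem_insert _ _) (mem_insert_of_mem _ rfl))
  constructor
  · rintro (h | ⟨hX, h⟩ | ⟨C, D, hC, hD, -, -, hCD, hs, rfl⟩)
    · exact Or.inl h.2
    · obtain ⟨T, e, hT, he, rfl⟩ := exists_transversal_of_isTheta hr hX
      refine Or.inr (Or.inl ⟨?_, ?_, fun C hC hCX => ?_⟩)
      · rw [ncard_insert_of_notMem he, hT.ncard]
      · refine (subsingleton_singleton (a := e.1)).anti ?_
        refine fullLegs_insert_subset.trans ?_
        simp [hT.fullLegs_eq]
      · exact h C ((hB.transversal C hC).isCycle hr) hCX hC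
    · refine Or.inr (Or.inr ?_)
      rcases leg_or_transversal_of_isCycle hr hC with ⟨i, rfl⟩ | h
      · rcases leg_or_transversal_of_isCycle hr hD with ⟨j, rfl⟩ | h
        · exact ⟨i, j, fun h => hCD (h ▸ rfl), two_legs_eq_union i j⟩
        · rw [h.vertexSpan, inter_univ, vertexSpan_leg] at hs
          exact absurd hs (hnot i)
      · obtain ⟨j, hj⟩ := hspan D hD
        rw [h.vertexSpan, univ_inter] at hs
        exact absurd (hs.anti hj) (hnot j)
  · rintro (h | ⟨hX, hs, h⟩ | ⟨i, j, hij, rfl⟩)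
    · exact Or.inl ⟨(hB.transversal X h).isCycle hr, h⟩
    · refine Or.inr (Or.inl ⟨?_, fun C _ hCX hC => h C hC hCX⟩)
      obtain ⟨-, i, hi⟩ := touched_full_of_ncard hX hs
      have hT : IsTransversal (X \ {(i, true)}) := by
        refine isTransversal_of_ncard ?_ ?_
        · rw [ncard_sdiff_singleton_of_mem (hi true), hX, Nat.add_sub_cancel]
        · ext j
          simp only [mem_empty_iff_false, iff_false]
          intro hj
          have : j = i := hs (fullLegs_mono sdiff_subset hj) hi
          exact (hj true).2 (by simp [this])
      have := hT.isTheta_insert hr (e := (i, true)) (by simp)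
      rwa [insert_sdiff_singleton, insert_eq_of_mem (hi true)] at this
    · have hnotB : ∀ l : ZMod r, {x : ZMod r × Bool | x.1 = l} ∉ B := fun l hl => by
        have := (hB.transversal _ hl).vertexSpan
        rw [vertexSpan_leg] at this
        exact leg_not_hamiltonian hr l this
      refine Or.inr (Or.inr ⟨_, _, isCycle_leg hr i, isCycle_leg hr j, hnotB i, hnotB j, ?_, ?_,
        two_legs_eq_union i j⟩)
      · intro h
        have : (i, true) ∈ {x : ZMod r × Bool | x.1 = j} := h ▸ rfl
        exact hij this
      · have h2 := zmod_one_add_one_ne_zero hr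
        rw [vertexSpan_leg, vertexSpan_leg]
        have hcyc : i = j + 1 → i + 1 ≠ j := by
          intro h3 h4
          rw [h3, add_assoc] at h4
          exact h2 (by simpa using h4)
        have hinj : i + 1 ≠ j + 1 := fun h => hij (add_right_cancel h)
        rintro a ⟨ha, ha'⟩ b ⟨hb, hb'⟩
        simp only [mem_insert_iff, mem_singleton_iff] at ha ha' hb hb'
        grind

theorem isLiftMatroid_spikeMatroid [NeZero r] (hr : 3 ≤ r) {B : Set (Set (ZMod r × Bool))}
    (hB : IsSpikeFamily B) : IsLiftMatroid (doubledCycle r) B (spikeMatroid B hB) :=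
  ⟨rfl, fun X => by
    rw [isLiftCircuit_doubledCycle_iff hr hB, spikeMatroid_isCircuit_iff]
    rwa [Nat.card_zmod]⟩

theorem isSpikeWith_spikeMatroid [NeZero r] (hr : 3 ≤ r) {B : Set (Set (ZMod r × Bool))}
    (hB : IsSpikeFamily B) : IsSpikeWith r B (spikeMatroid B hB) :=
  ⟨hr, hB.isLinearClass hr, fun C hC => (isHamiltonianCycle_iff hr).2 (hB.transversal C hC),
    isLiftMatroid_spikeMatroid hr hB⟩

theorem IsSpikeWith.eq_spikeMatroid {B : Set (Set (ZMod r × Bool))} {L : Matroid (ZMod r × Bool)}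
    (h : IsSpikeWith r B L) : ∃ (_ : NeZero r) (hB : IsSpikeFamily B), L = spikeMatroid B hB := by
  obtain ⟨hr, h1, h2, h3⟩ := h
  have : NeZero r := ⟨by omega⟩
  have hB := isSpikeFamily_of_isLinearClass hr h1 h2
  exact ⟨this, hB, h3.unique (isLiftMatroid_spikeMatroid hr hB)⟩

end DoubledCycle

/-! ### Transport of matroids along bijections -/

section Transport

open Set Matroid

variable {α β : Type*}

theorem isIso_mapEquiv (M : Matroid α) (e : α ≃ β) : IsIso M (M.mapEquiv e) := by
  refine ⟨e.image M.E, fun I => ?_⟩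
  have h : (Subtype.val '' (e.image M.E '' I) : Set β) = e '' (Subtype.val '' I) := by
    rw [image_image, image_image]
    rfl
  refine Iff.trans ?_ (iff_of_eq (congrArg (M.mapEquiv e).Indep h.symm))
  rw [mapEquiv_indep_iff, Equiv.symm_image_image]

theorem mapEquiv_symm_mapEquiv (M : Matroid α) (e : α ≃ β) :
    (M.mapEquiv e).mapEquiv e.symm = M := by
  refine Matroid.ext_indep ?_ fun I _ => ?_
  · rw [mapEquiv_ground_eq, mapEquiv_ground_eq, Equiv.symm_image_image]
  · rw [mapEquiv_indep_iff, mapEquiv_indep_iff, Equiv.symm_symm, Equiv.symm_image_image]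

theorem mapEquiv_delete (M : Matroid α) (e : α ≃ β) (D : Set α) :
    (M ＼ D).mapEquiv e = M.mapEquiv e ＼ (e '' D) := by
  refine Matroid.ext_indep ?_ fun I _ => ?_
  · simp [image_sdiff e.injective]
  · rw [mapEquiv_indep_iff, delete_indep_iff, delete_indep_iff, mapEquiv_indep_iff,
      ← disjoint_image_iff e.injective, Equiv.image_symm_image]

theorem mapEquiv_dual (M : Matroid α) (e : α ≃ β) : (M✶).mapEquiv e = (M.mapEquiv e)✶ := by
  rw [mapEquiv_eq_map, mapEquiv_eq_map, map_dual]

theorem mapEquiv_contract (M : Matroid α) (e : α ≃ β) (C : Set α) :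
    (M ／ C).mapEquiv e = M.mapEquiv e ／ (e '' C) := by
  rw [← dual_delete_dual, mapEquiv_dual, mapEquiv_delete, mapEquiv_dual, dual_delete_dual]

theorem IsMinor.mapEquiv {M N : Matroid α} (h : N ≤m M) (e : α ≃ β) :
    N.mapEquiv e ≤m M.mapEquiv e := by
  obtain ⟨C, D, rfl⟩ := h
  exact ⟨e '' C, e '' D, by rw [mapEquiv_delete, mapEquiv_contract]⟩

theorem IsStrictMinor.mapEquiv {M N : Matroid α} (h : N <m M) (e : α ≃ β) :
    N.mapEquiv e <m M.mapEquiv e := by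
  refine ⟨IsMinor.mapEquiv h.1 e, fun h' => h.2 ?_⟩
  have := IsMinor.mapEquiv h' e.symm
  rwa [mapEquiv_symm_mapEquiv, mapEquiv_symm_mapEquiv] at this

theorem IsFlat.mapEquiv {M : Matroid α} {F : Set α} (h : M.IsFlat F) (e : α ≃ β) :
    (M.mapEquiv e).IsFlat (e '' F) := by
  refine ⟨fun I X hI hX => ?_, image_mono h.subset_ground⟩
  rw [mapEquiv_isBasis_iff] at hI hX
  rw [Equiv.symm_image_image] at hI
  have := image_mono (f := e) (h.subset_of_isBasis_of_isBasis hI hX)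
  rwa [Equiv.image_symm_image] at this

theorem IsCircuit.mapEquiv {M : Matroid α} {C : Set α} (h : M.IsCircuit C) (e : α ≃ β) :
    (M.mapEquiv e).IsCircuit (e '' C) := by
  refine ⟨by simpa using h.1, fun D hD hDC => ?_⟩
  rw [mapEquiv_dep_iff] at hD
  have h1 : e.symm '' D ⊆ C := by
    have := image_mono (f := e.symm) hDC
    rwa [Equiv.symm_image_image] at this
  have := image_mono (f := e) (h.2 hD h1)
  rwa [Equiv.image_symm_image] at this

theorem IsHyperplane.mapEquiv {M : Matroid α} {H : Set α} (h : IsHyperplane M H) (e : α ≃ β) :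
    IsHyperplane (M.mapEquiv e) (e '' H) := by
  refine ⟨⟨IsFlat.mapEquiv h.1.1 e, fun h' => h.1.2 (e.injective.image_injective h')⟩, ?_⟩
  rintro F ⟨hF, hFE⟩ hHF
  have h1 : H ⊆ e.symm '' F := by
    have := image_mono (f := e.symm) hHF
    rwa [Equiv.symm_image_image] at this
  have h2 : M.IsFlat (e.symm '' F) := by
    have := IsFlat.mapEquiv hF e.symm
    rwa [mapEquiv_symm_mapEquiv] at this
  have h3 := image_mono (f := e) (h.2 ⟨h2, fun h' => hFE ?_⟩ h1)
  · rwa [Equiv.image_symm_image] at h3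
  · rw [mapEquiv_ground_eq, ← h', Equiv.image_symm_image]

theorem IsCircuitHyperplane.mapEquiv {M : Matroid α} {H : Set α} (h : IsCircuitHyperplane M H)
    (e : α ≃ β) : IsCircuitHyperplane (M.mapEquiv e) (e '' H) :=
  ⟨IsCircuit.mapEquiv h.1 e, IsHyperplane.mapEquiv h.2 e⟩

theorem isCircuitHyperplane_mapEquiv_iff {M : Matroid α} {e : α ≃ β} {H : Set β} :
    IsCircuitHyperplane (M.mapEquiv e) H ↔ ∃ C, IsCircuitHyperplane M C ∧ e '' C = H := by
  constructor
  · intro h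
    have := IsCircuitHyperplane.mapEquiv h e.symm
    rw [mapEquiv_symm_mapEquiv] at this
    exact ⟨_, this, Equiv.image_symm_image _ _⟩
  · rintro ⟨C, hC, rfl⟩
    exact IsCircuitHyperplane.mapEquiv hC e

theorem InSpikeClass.of_isIso {k : ℕ} {M : Matroid α} {N : Matroid β} (h : InSpikeClass k N)
    (hMN : IsIso M N) : InSpikeClass k M := by
  obtain ⟨r, B, L, K, h1, h2, h3, h4⟩ := h
  exact ⟨r, B, L, K, h1, h2, h3, hMN.trans h4⟩

theorem IsExcludedMinor.mapEquiv {k : ℕ} {M : Matroid α} (h : IsExcludedMinor k M) (e : α ≃ β) :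
    IsExcludedMinor k (M.mapEquiv e) := by
  refine ⟨fun h' => h.1 (h'.of_isIso (isIso_mapEquiv M e)), fun N hN => ?_⟩
  have h1 := IsStrictMinor.mapEquiv hN e.symm
  rw [mapEquiv_symm_mapEquiv] at h1
  exact (h.2 _ h1).of_isIso (isIso_mapEquiv N e.symm)

theorem IsCoveredSpike.mapEquiv {m : ℕ} {M : Matroid α} (h : IsCoveredSpike m M) (e : α ≃ β) :
    IsCoveredSpike m (M.mapEquiv e) := by
  obtain ⟨⟨r, B, L, hL, hML⟩, h2, h3⟩ := h
  refine ⟨⟨r, B, L, hL, (isIso_mapEquiv M e).symm.trans hML⟩, ?_, ?_⟩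
  · have : {C | IsCircuitHyperplane (M.mapEquiv e) C} =
        (e '' ·) '' {C | IsCircuitHyperplane M C} := by
      ext H
      exact isCircuitHyperplane_mapEquiv_iff
    rw [this, e.injective.image_injective.encard_image, h2]
  · rintro _ ⟨x, hx, rfl⟩
    obtain ⟨⟨C, hC, hxC⟩, D, hD, hxD⟩ := h3 x hx
    exact ⟨⟨e '' C, IsCircuitHyperplane.mapEquiv hC e, mem_image_of_mem e hxC⟩,
      e '' D, IsCircuitHyperplane.mapEquiv hD e, fun h => hxD (e.injective.mem_set_image.1 h)⟩

/-! ### Circuits and independent sets under isomorphism -/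

theorem isCircuit_image_val_iff {M : Matroid α} {X : Set M.E} :
    M.IsCircuit (Subtype.val '' X) ↔
      ¬ M.Indep (Subtype.val '' X) ∧ ∀ Y : Set M.E, Y ⊂ X → M.Indep (Subtype.val '' Y) := by
  have hE : ∀ Y : Set M.E, (Subtype.val '' Y : Set α) ⊆ M.E := fun Y => by
    rintro _ ⟨y, _, rfl⟩
    exact y.2
  constructor
  · intro h
    exact ⟨h.not_indep, fun Y hY => h.ssubset_indep (Subtype.val_injective.image_strictMono hY)⟩
  · rintro ⟨h1, h2⟩
    refine ⟨⟨h1, hE X⟩, fun D hD hDX => ?_⟩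
    obtain ⟨Y, rfl⟩ : ∃ Y : Set M.E, Subtype.val '' Y = D :=
      ⟨Subtype.val ⁻¹' D, by simpa using hD.2⟩
    have hYX : Y ⊆ X := (image_subset_image_iff Subtype.val_injective).1 hDX
    rcases hYX.eq_or_ssubset with rfl | hlt
    · exact Subset.rfl
    · exact absurd (h2 Y hlt) hD.1

theorem isCircuit_image_iff_of_equiv {M : Matroid α} {N : Matroid β} {f : M.E ≃ N.E}
    (hf : ∀ I : Set M.E, M.Indep (Subtype.val '' I) ↔ N.Indep (Subtype.val '' (f '' I)))
    (X : Set M.E) :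
    M.IsCircuit (Subtype.val '' X) ↔ N.IsCircuit (Subtype.val '' (f '' X)) := by
  rw [isCircuit_image_val_iff, isCircuit_image_val_iff, hf]
  refine and_congr_right fun _ => ⟨fun h Y hY => ?_, fun h Y hY => ?_⟩
  · have h1 := h (f.symm '' Y) (by
      have := f.symm.injective.image_strictMono hY
      rwa [Equiv.symm_image_image] at this)
    rwa [hf, Equiv.image_symm_image] at h1
  · exact (hf Y).2 (h _ (f.injective.image_strictMono hY))

theorem IsIso.encard_circuits_le {M : Matroid α} {N : Matroid β} (h : IsIso M N) (t : ℕ) :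
    {X | M.IsCircuit X ∧ X.ncard = t}.encard ≤ {X | N.IsCircuit X ∧ X.ncard = t}.encard := by
  obtain ⟨f, hf⟩ := h
  have hpre : ∀ {X}, M.IsCircuit X →
      (Subtype.val '' (Subtype.val ⁻¹' X : Set M.E) : Set α) = X := fun hX => by
    simpa using hX.subset_ground
  refine encard_le_encard_of_injOn
    (f := fun X => (Subtype.val '' (f '' (Subtype.val ⁻¹' X : Set M.E)) : Set β)) ?_ ?_
  · rintro X ⟨hX, rfl⟩
    refine ⟨(isCircuit_image_iff_of_equiv hf _).1 (by rwa [hpre hX]), ?_⟩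
    rw [ncard_image_of_injective _ Subtype.val_injective, ncard_image_of_injective _ f.injective,
      ← ncard_image_of_injective _ Subtype.val_injective, hpre hX]
  · rintro X ⟨hX, -⟩ Y ⟨hY, -⟩ hXY
    have h1 := f.injective.image_injective (Subtype.val_injective.image_injective hXY)
    rw [← hpre hX, ← hpre hY, h1]

theorem IsIso.exists_indep {M : Matroid α} {N : Matroid β} (h : IsIso M N) {I : Set α}
    (hI : M.Indep I) : ∃ J, N.Indep J ∧ J.ncard = I.ncard := by
  obtain ⟨f, hf⟩ := h
  have hpre : (Subtype.val '' (Subtype.val ⁻¹' I : Set M.E) : Set α) = I := by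
    simpa using hI.subset_ground
  refine ⟨_, (hf (Subtype.val ⁻¹' I)).1 (by rwa [hpre]), ?_⟩
  rw [ncard_image_of_injective _ Subtype.val_injective, ncard_image_of_injective _ f.injective,
    ← ncard_image_of_injective _ Subtype.val_injective, hpre]

end Transport

/-! ### Minors of spikes -/

section Minors

open Set Matroid

variable {ι : Type*} [Finite ι] [Nonempty ι] {B : Set (Set (ι × Bool))} {hB : IsSpikeFamily B}

/-- A set avoiding `x` is never a balanced transversal through `x`, so those transversals do not
affect independence in the deletion. -/
theorem spikeMatroid_delete_singleton (x : ι × Bool) :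
    spikeMatroid B hB ＼ {x} =
      spikeMatroid {C | C ∈ B ∧ x ∉ C} (hB.subset fun _ h => h.1) ＼ {x} := by
  refine Matroid.ext_indep rfl fun I _ => ?_
  simp only [delete_indep_iff, spikeMatroid_indep_iff, SpikeIndep, disjoint_singleton_right,
    mem_ofPred_eq]
  tauto

theorem spikeMatroid_indep_singleton (hr : 3 ≤ Nat.card ι) (x : ι × Bool) :
    (spikeMatroid B hB).Indep {x} := by
  refine spikeMatroid_indep_iff.2 ⟨?_, ?_, fun h => ?_⟩
  · have h1 : ({x} : Set (ι × Bool)) = insert x ∅ := by simp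
    rw [h1]
    refine (subsingleton_singleton (a := x.1)).anti (fullLegs_insert_subset.trans ?_)
    simp [fullLegs]
  · rw [ncard_singleton]
    omega
  · have := (hB.transversal _ h).ncard
    rw [ncard_singleton] at this
    omega

/-- Independence of `I` in the contraction tests a set containing `x`, which is never a transversal
avoiding `x`. -/
theorem spikeMatroid_contract_singleton (hr : 3 ≤ Nat.card ι) (x : ι × Bool) :
    spikeMatroid B hB ／ {x} =
      spikeMatroid {C | C ∈ B ∧ x ∈ C} (hB.subset fun _ h => h.1) ／ {x} := by
  refine Matroid.ext_indep rfl fun I _ => ?_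
  rw [(spikeMatroid_indep_singleton hr x).contract_indep_iff,
    (spikeMatroid_indep_singleton hr x).contract_indep_iff]
  simp [SpikeIndep]

theorem exists_isMinor_contract_or_delete {α : Type*} {M N : Matroid α} (h : N <m M) :
    ∃ x, N ≤m M ／ {x} ∨ N ≤m M ＼ {x} := by
  obtain ⟨⟨C, D, rfl⟩, hne⟩ := isStrictMinor_iff_isMinor_ne.1 h
  rcases C.eq_empty_or_nonempty with rfl | ⟨x, hx⟩
  · rcases D.eq_empty_or_nonempty with rfl | ⟨x, hx⟩
    · exact absurd (by simp) hne
    · refine ⟨x, Or.inr ⟨∅, D, ?_⟩⟩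
      rw [contract_empty, contract_empty, delete_delete, singleton_union, insert_eq_of_mem hx]
  · refine ⟨x, Or.inl ⟨C, D, ?_⟩⟩
    rw [contract_contract, singleton_union, insert_eq_of_mem hx]

/-- After reducing to contraction of an independent set `K`, the rank bound gives `t + |K| ≤ r`. A
circuit of size `t` lifts to a spike circuit `C` with `t ≤ |C| ≤ t + |K|`: too large for two legs
and too small for `r + 1` elements. So `C` is balanced, and it determines the original circuit as `C
\ K`. -/
theorem encard_circuits_le_of_isMinor_spikeMatroid {N : Matroid (ι × Bool)} {t : ℕ} (ht : 5 ≤ t)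
    (hr : 3 ≤ Nat.card ι) (hN : N ≤m spikeMatroid B hB)
    (hI : ∃ I, N.Indep I ∧ I.ncard = t) :
    {X | N.IsCircuit X ∧ X.ncard = t}.encard ≤ B.encard := by
  obtain ⟨X, Y, rfl⟩ := hN
  obtain ⟨K, hK⟩ := (spikeMatroid B hB).exists_isBasis' X
  rw [hK.contract_eq_contract_delete, delete_delete] at hI ⊢
  obtain ⟨I, hI, rfl⟩ := hI
  have h1 := (hK.indep.contract_indep_iff.1 (delete_indep_iff.1 hI).1)
  have h2 := ((spikeMatroid_indep_iff).1 h1.2).2.1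
  rw [ncard_union_eq h1.1] at h2
  have key : ∀ D, (spikeMatroid B hB ／ K ＼ (X \ K ∪ Y)).IsCircuit D ∧ D.ncard = I.ncard →
      ∃ C ∈ B, D = C \ K := by
    rintro D ⟨hD, hDI⟩
    have hD1 := (delete_isCircuit_iff.1 hD).1
    have hDK : Disjoint D K := (subset_sdiff.1 hD1.subset_ground).2
    obtain ⟨C, hC, hDC, hCD⟩ := hD1.exists_subset_isCircuit_of_contract
    have hle : C.ncard ≤ D.ncard + K.ncard := (ncard_le_ncard hCD).trans (ncard_union_le D K)
    have hge : D.ncard ≤ C.ncard := ncard_le_ncard hDC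
    refine ⟨C, ?_, ?_⟩
    · rcases (spikeMatroid_isCircuit_iff hr).1 hC with h | ⟨h, -⟩ | ⟨i, j, hij, rfl⟩
      · exact h
      · omega
      · rw [ncard_two_legs hij] at hge
        omega
    · refine (subset_sdiff.2 ⟨hDC, hDK⟩).antisymm fun y hy => ?_
      exact (hCD hy.1).resolve_right hy.2
  have hsub : {D | (spikeMatroid B hB ／ K ＼ (X \ K ∪ Y)).IsCircuit D ∧ D.ncard = I.ncard} ⊆
      (· \ K) '' B := fun D hD => by
    obtain ⟨C, hC, rfl⟩ := key D hD
    exact ⟨C, hC, rfl⟩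
  exact (encard_le_encard hsub).trans (encard_image_le _ _)

theorem exists_spikeIndep_ncard_eq (hB : IsSpikeFamily B) {C : Set (ι × Bool)} (hC : C ∈ B) :
    ∃ I, SpikeIndep B I ∧ I.ncard = Nat.card ι := by
  obtain ⟨i⟩ := ‹Nonempty ι›
  have hCt := hB.transversal C hC
  -- Switching `C` in one leg gives a transversal that separation keeps out of `B`.
  have hI : IsTransversal {x : ι × Bool | x ∈ C ↔ x.1 ≠ i} := fun j => by
    have := hCt j
    simp only [mem_ofPred_eq]
    tauto
  refine ⟨_, ⟨?_, hI.ncard.le, fun h => ?_⟩, hI.ncard⟩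
  · rw [hI.fullLegs_eq]
    exact subsingleton_empty
  · have h1 := hB.separated C hC _ h i fun x hx hxi => ⟨fun _ => hxi, fun _ => hx⟩
    have h2 := Set.ext_iff.1 h1 (i, true)
    simp only [mem_ofPred_eq, ne_eq, not_true_eq_false, iff_false] at h2
    tauto

theorem not_inSpikeClass_spikeMatroid {k : ℕ} (hr : 5 ≤ Nat.card ι) (hk : k < B.encard) :
    ¬ InSpikeClass k (spikeMatroid B hB) := by
  rintro ⟨r, B', L, N, hL, hB'k, hN, hiso⟩
  have h3 : 3 ≤ Nat.card (ZMod r) := by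
    rw [Nat.card_zmod]
    exact hL.1
  obtain ⟨hr0, hB', rfl⟩ := hL.eq_spikeMatroid
  obtain ⟨C, hC⟩ : B.Nonempty := by
    rw [nonempty_iff_ne_empty]
    rintro rfl
    simp at hk
  obtain ⟨I, hI, hIc⟩ := exists_spikeIndep_ncard_eq hB hC
  obtain ⟨J, hJ, hJc⟩ := hiso.exists_indep (spikeMatroid_indep_iff (hB := hB) |>.2 hI)
  have h1 := encard_circuits_le_of_isMinor_spikeMatroid hr h3 hN ⟨J, hJ, hJc.trans hIc⟩
  have h2 := hiso.encard_circuits_le (Nat.card ι)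
  have h4 : B ⊆ {X | (spikeMatroid B hB).IsCircuit X ∧ X.ncard = Nat.card ι} := fun D hD =>
    ⟨(spikeMatroid_isCircuit_iff (by omega)).2 (Or.inl hD), (hB.transversal D hD).ncard⟩
  exact absurd (hk.trans_le ((encard_le_encard h4).trans (h2.trans (h1.trans hB'k)))) (lt_irrefl _)

theorem isExcludedMinor_spikeMatroid {r : ℕ} [NeZero r] {k : ℕ} {B : Set (Set (ZMod r × Bool))}
    {hB : IsSpikeFamily B} (hr : 5 ≤ r) (hk : B.encard = k + 1)
    (hcov : ∀ x, (∃ C ∈ B, x ∈ C) ∧ ∃ C ∈ B, x ∉ C) : IsExcludedMinor k (spikeMatroid B hB) := by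
  have hfin : B.Finite := finite_of_encard_eq_coe (by exact_mod_cast hk : _ = ((k + 1 : ℕ) : ℕ∞))
  have hcard : ∀ B' ⊂ B, B'.encard ≤ k := fun B' h => by
    have h1 := (hfin.subset h.subset).encard_lt_encard h
    rw [hk] at h1
    exact Order.le_of_lt_add_one h1
  refine ⟨not_inSpikeClass_spikeMatroid (by rwa [Nat.card_zmod]) ?_, fun N hN => ?_⟩
  · rw [hk]
    exact_mod_cast Nat.lt_succ_self k
  obtain ⟨x, hx | hx⟩ := exists_isMinor_contract_or_delete hN
  · rw [spikeMatroid_contract_singleton (by rw [Nat.card_zmod]; omega)] at hx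
    refine ⟨r, _, _, N, isSpikeWith_spikeMatroid (by omega) _, hcard _ ?_,
      hx.trans ⟨{x}, ∅, (delete_empty _).symm⟩, IsIso.refl N⟩
    obtain ⟨C, hC, hxC⟩ := (hcov x).2
    exact ⟨fun _ h => h.1, fun h => hxC (h hC).2⟩
  · rw [spikeMatroid_delete_singleton] at hx
    refine ⟨r, _, _, N, isSpikeWith_spikeMatroid (by omega) _, hcard _ ?_,
      hx.trans ⟨∅, {x}, by rw [contract_empty]⟩, IsIso.refl N⟩
    obtain ⟨C, hC, hxC⟩ := (hcov x).1
    exact ⟨fun _ h => h.1, fun h => (h hC).2 hxC⟩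

end Minors

/-! ### Circuit-hyperplanes of spikes -/

section CircuitHyperplanes

open Set Matroid

variable {ι : Type*} [Finite ι] [Nonempty ι] {B : Set (Set (ι × Bool))} {hB : IsSpikeFamily B}

theorem mem_closure_of_two_full_legs (hr : 3 ≤ Nat.card ι) {X : Set (ι × Bool)} {x : ι × Bool}
    {i : ι} (hx : x.1 ∈ fullLegs (insert x X)) (hi : i ∈ fullLegs X) (hxX : x ∉ X) :
    x ∈ (spikeMatroid B hB).closure X := by
  refine (mem_closure_iff_exists_isCircuit hxX).2
    ⟨{y | y.1 = x.1 ∨ y.1 = i}, ?_, (spikeMatroid_isCircuit_iff hr).2 ?_, Or.inl rfl⟩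
  · rintro ⟨j, b⟩ (rfl | rfl)
    exacts [hx b, mem_insert_of_mem _ (hi b)]
  · refine Or.inr (Or.inr ⟨x.1, i, ?_, rfl⟩)
    rintro h
    exact hxX (h ▸ hi x.2 : (x.1, x.2) ∈ X)

theorem isCircuitHyperplane_of_mem (hr : 3 ≤ Nat.card ι) {C : Set (ι × Bool)} (hC : C ∈ B) :
    IsCircuitHyperplane (spikeMatroid B hB) C := by
  have hCt := hB.transversal C hC
  have hfull : ∀ e, e ∉ C → e.1 ∈ fullLegs (insert e C) := fun e he =>
    fullLegs_insert_of_touched e he (by simp [hCt.fst_image])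
  refine ⟨(spikeMatroid_isCircuit_iff hr).2 (Or.inl hC), ⟨?_, ?_⟩, ?_⟩
  · refine isFlat_iff_closure_eq.2
      (Subset.antisymm (fun e he => by_contra fun heC => ?_) (subset_closure _ C))
    obtain ⟨D, hDC, hD, heD⟩ := (mem_closure_iff_exists_isCircuit heC).1 he
    have hfe : ∀ i ∈ fullLegs D, i = e.1 := fun i hi => by
      have := fullLegs_insert_subset (fullLegs_mono hDC hi)
      rwa [hCt.fullLegs_eq, insert_empty_eq] at this
    rcases (spikeMatroid_isCircuit_iff hr).1 hD with h | ⟨h, -, h'⟩ | ⟨i, j, hij, rfl⟩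
    · refine heC (hB.separated D h C hC e.1 (fun x hx hxe => ?_) ▸ heD)
      exact (hDC hx).resolve_left fun h => hxe (h ▸ rfl)
    · have hDe : D = insert e C := eq_of_subset_of_ncard_le hDC (by
        rw [ncard_insert_of_notMem heC, hCt.ncard, h])
      exact h' C hC (hDe ▸ subset_insert e C)
    · rw [fullLegs_two_legs] at hfe
      exact hij ((hfe i (by simp)).trans (hfe j (by simp)).symm)
  · intro h
    have := hCt.fullLegs_eq
    rw [h] at this
    obtain ⟨i⟩ := ‹Nonempty ι›
    exact (this ▸ (fun b => mem_univ _ : i ∈ fullLegs univ) : i ∈ (∅ : Set ι))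
  · rintro F ⟨hF, hFE⟩ hCF
    -- Adding any `e` to `C` fills a leg. Every further `y` completes its own leg, and these two
    -- legs form a circuit through `y`, so the closure is everything.
    by_contra hcon
    obtain ⟨e, heF, heC⟩ := not_subset.1 hcon
    refine hFE (eq_univ_of_forall fun y => ?_)
    by_cases hy : y ∈ insert e C
    · exact insert_subset heF hCF hy
    have hyC : y ∉ C := fun h => hy (mem_insert_of_mem _ h)
    have h1 : y ∈ (spikeMatroid B hB).closure (insert e C) :=
      mem_closure_of_two_full_legs hr
        (fullLegs_mono (insert_subset_insert (subset_insert e C)) (hfull y hyC)) (hfull e heC) hy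
    have h2 := (spikeMatroid B hB).closure_subset_closure (insert_subset heF hCF) h1
    rwa [hF.closure] at h2

theorem isCircuitHyperplane_spikeMatroid_iff (hr : 5 ≤ Nat.card ι) {C : Set (ι × Bool)} :
    IsCircuitHyperplane (spikeMatroid B hB) C ↔ C ∈ B := by
  have hr3 : 3 ≤ Nat.card ι := by omega
  refine ⟨fun ⟨hC, hH⟩ => ?_, isCircuitHyperplane_of_mem hr3⟩
  rcases (spikeMatroid_isCircuit_iff hr3).1 hC with h | ⟨h, h', -⟩ | ⟨i, j, hij, rfl⟩
  · exact h
  · obtain ⟨h1, l, hl⟩ := touched_full_of_ncard h h'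
    refine absurd (eq_univ_of_forall fun y => ?_) hH.1.2
    by_contra hy
    have := mem_closure_of_two_full_legs (hB := hB) hr3
      (fullLegs_insert_of_touched y hy (by simp [h1])) hl hy
    rw [hH.1.1.closure] at this
    exact hy this
  -- Two legs and an element of a third do not span: a circuit inside these plus `(m, true)` touches
  -- at most four legs, fewer than all of them, so it is a pair of legs, but `(m, false)` is absent.
  -- The two legs are therefore not a maximal proper flat.
  · exfalso
    have hex : ∀ S : Set ι, S.ncard < 5 → ∃ l, l ∉ S := fun S hS => by
      by_contra hcon
      push Not at hcon
      rw [eq_univ_of_forall hcon, ncard_univ] at hS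
      omega
    obtain ⟨l, hl⟩ := hex {i, j} ((ncard_insert_le i {j}).trans_lt (by simp))
    have hc3 : ({l, i, j} : Set ι).ncard ≤ 3 := by
      refine (ncard_insert_le l {i, j}).trans ?_
      rw [ncard_pair hij]
    obtain ⟨m, hm⟩ := hex {l, i, j} (by omega)
    have hc4 : ({m, l, i, j} : Set ι).ncard ≤ 4 := (ncard_insert_le m {l, i, j}).trans (by omega)
    simp only [mem_insert_iff, mem_singleton_iff, not_or] at hl hm
    set X : Set (ι × Bool) := {x | x.1 = i ∨ x.1 = j} with hX
    have hlX : (l, true) ∉ X := fun h => h.elim hl.1 hl.2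
    have hmX : (m, true) ∉ insert (l, true) X := by
      rintro (h | h)
      · exact hm.1 (congrArg Prod.fst h)
      · exact h.elim hm.2.1 hm.2.2
    have hmcl : (m, true) ∉ (spikeMatroid B hB).closure (insert (l, true) X) := by
      intro h
      obtain ⟨D, hDX, hD, hmD⟩ := (mem_closure_iff_exists_isCircuit hmX).1 h
      have hfst : Prod.fst '' D ⊆ {m, l, i, j} := by
        refine (image_mono hDX).trans ?_
        rw [image_insert_eq, image_insert_eq, fst_image_two_legs]
      have hne : Prod.fst '' D ≠ univ := by
        intro h
        have h1 := ncard_le_ncard hfst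
        rw [h, ncard_univ] at h1
        omega
      rcases (spikeMatroid_isCircuit_iff hr3).1 hD with h | ⟨h, h', -⟩ | ⟨a, b, hab, rfl⟩
      · exact hne (hB.transversal D h).fst_image
      · exact hne (touched_full_of_ncard h h').1
      · have h1 : (m, false) ∈ {x : ι × Bool | x.1 = a ∨ x.1 = b} := hmD
        rcases hDX h1 with h | h | h
        · simp at h
        · simp at h
        · exact h.elim hm.2.1 hm.2.2
    have h1 : X ⊆ insert (l, true) X := subset_insert _ _
    have h2 : insert (l, true) X ⊆ (spikeMatroid B hB).closure (insert (l, true) X) :=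
      subset_closure _ _
    refine hlX (hH.2 ⟨isFlat_closure _, fun h => hmcl ?_⟩ (h1.trans h2) (h2 (mem_insert _ _)))
    rw [h]
    exact mem_univ _

theorem isCoveredSpike_spikeMatroid {r : ℕ} [NeZero r] {m : ℕ} {B : Set (Set (ZMod r × Bool))}
    {hB : IsSpikeFamily B} (hr : 5 ≤ r) (hm : B.encard = m)
    (hcov : ∀ x, (∃ C ∈ B, x ∈ C) ∧ ∃ C ∈ B, x ∉ C) : IsCoveredSpike m (spikeMatroid B hB) := by
  have hr' : 5 ≤ Nat.card (ZMod r) := by rwa [Nat.card_zmod]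
  simp only [IsCoveredSpike, isCircuitHyperplane_spikeMatroid_iff hr']
  exact ⟨⟨r, B, _, isSpikeWith_spikeMatroid (by omega) hB, IsIso.refl _⟩, hm, fun x _ => hcov x⟩

end CircuitHyperplanes

/-! ### Families of transversals given by column maps -/

section ColumnFamily

open Set

variable {ι : Type*} {k : ℕ}

/-- The column map `h` extended by a constant zeroth row. -/
def extendedColumn (h : ι → Fin k → Bool) (i : ι) (j : Option (Fin k)) : Bool := j.elim false (h i)

/-- The transversal which is the graph of a row of the column map `h`. -/
def rowTransversal (h : ι → Fin k → Bool) (j : Option (Fin k)) : Set (ι × Bool) :=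
  {x | x.2 = extendedColumn h x.1 j}

/-- All columns of `h` are nonzero, and all unit vectors occur at least twice. -/
structure IsRichColumnMap (h : ι → Fin k → Bool) : Prop where
  nonzero : ∀ i, ∃ a, h i a = true
  unit : ∀ a, ∃ i i', i ≠ i' ∧ (h i = fun b => decide (b = a)) ∧ h i' = fun b => decide (b = a)

theorem isTransversal_rowTransversal (h : ι → Fin k → Bool) (j : Option (Fin k)) :
    IsTransversal (rowTransversal h j) := fun i => by
  simp only [rowTransversal, mem_ofPred_eq]
  cases extendedColumn h i j <;> simp

/-- Distinct rows differ in some unit column, and that column occurs twice, so one occurrence lies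
outside leg `i`. -/
theorem IsRichColumnMap.eq_of_subset {h : ι → Fin k → Bool} (hh : IsRichColumnMap h)
    {j j' : Option (Fin k)} (i : ι)
    (hsub : ∀ x ∈ rowTransversal h j, x.1 ≠ i → x ∈ rowTransversal h j') : j = j' := by
  by_contra hne
  obtain ⟨a, ha⟩ : ∃ a, ¬ (j = some a ↔ j' = some a) := by
    by_contra hcon
    push Not at hcon
    exact hne (Option.ext fun a => hcon a)
  obtain ⟨m, hmi, hm⟩ : ∃ m, m ≠ i ∧ h m = fun b => decide (b = a) := by
    obtain ⟨l, l', hl, h1, h2⟩ := hh.unit a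
    by_cases hli : l = i
    · exact ⟨l', fun h => hl (hli.trans h.symm), h2⟩
    · exact ⟨l, hli, h1⟩
  have hcol : ∀ l, extendedColumn h m l = decide (l = some a) := fun l => by
    cases l <;> simp [extendedColumn, hm]
  have h1 : extendedColumn h m j = extendedColumn h m j' := hsub (m, extendedColumn h m j) rfl hmi
  rw [hcol, hcol, decide_eq_decide] at h1
  exact ha h1

theorem IsRichColumnMap.isSpikeFamily {h : ι → Fin k → Bool} (hh : IsRichColumnMap h) :
    IsSpikeFamily (range (rowTransversal h)) := by
  refine ⟨?_, ?_⟩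
  · rintro _ ⟨j, rfl⟩
    exact isTransversal_rowTransversal h j
  · rintro _ ⟨j, rfl⟩ _ ⟨j', rfl⟩ i hsub
    rw [hh.eq_of_subset i hsub]

theorem IsRichColumnMap.rowTransversal_injective [Nonempty ι] {h : ι → Fin k → Bool}
    (hh : IsRichColumnMap h) : Function.Injective (rowTransversal h) := fun _ _ hj =>
  hh.eq_of_subset (Classical.arbitrary ι) fun _ hx _ => hj ▸ hx

theorem IsRichColumnMap.encard_range [Nonempty ι] {h : ι → Fin k → Bool}
    (hh : IsRichColumnMap h) : (range (rowTransversal h)).encard = k + 1 := by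
  rw [← image_univ, hh.rowTransversal_injective.encard_image, encard_univ]
  simp

theorem IsRichColumnMap.exists_mem_exists_notMem {h : ι → Fin k → Bool} (hh : IsRichColumnMap h)
    (x : ι × Bool) : (∃ C ∈ range (rowTransversal h), x ∈ C) ∧
      ∃ C ∈ range (rowTransversal h), x ∉ C := by
  obtain ⟨i, b⟩ := x
  obtain ⟨a, ha⟩ := hh.nonzero i
  simp only [exists_range_iff]
  cases b
  · exact ⟨⟨none, rfl⟩, some a, by simp [rowTransversal, extendedColumn, ha]⟩
  · exact ⟨⟨some a, by simp [rowTransversal, extendedColumn, ha]⟩, none,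
      by simp [rowTransversal, extendedColumn]⟩

/-- This expresses column multiplicities through membership in the rows alone, which an isomorphism
respects. Avoiding the zeroth row forces the `true` side of a leg, so each leg is counted once. -/
theorem ncard_column_fiber (h : ι → Fin k → Bool) (w : Fin k → Bool) :
    {i | h i = w}.ncard =
      {x | ∀ j : Option (Fin k), x ∈ rowTransversal h j ↔ j.elim false w = true}.ncard := by
  rw [← ncard_image_of_injective {i | h i = w}
    (fun i j hij => congrArg Prod.fst hij : Function.Injective fun i : ι => (i, true))]
  congr 1
  ext ⟨i, b⟩
  simp only [mem_image, mem_ofPred_eq, Prod.mk.injEq, Option.forall, rowTransversal,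
    extendedColumn, Option.elim_none, Option.elim_some, Bool.false_eq_true, iff_false,
    Bool.not_eq_false]
  constructor
  · rintro ⟨i, rfl, rfl, rfl⟩
    exact ⟨rfl, fun a => eq_comm⟩
  · rintro ⟨rfl, h2⟩
    refine ⟨i, funext fun a => ?_, rfl, rfl⟩
    have := h2 a
    revert this
    cases h i a <;> cases w a <;> simp

variable [Finite ι]

theorem exists_map_ncard_fiber {W : Type*} [Fintype W] (n : W → ℕ) (hn : ∑ w, n w ≤ Nat.card ι) :
    ∃ F : ι → Option W, ∀ w, {i | F i = some w}.ncard = n w := by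
  have := Fintype.ofFinite ι
  have e : (Σ w, Fin (n w)) ⊕ Fin (Nat.card ι - ∑ w, n w) ≃ ι := Fintype.equivOfCardEq (by
    rw [Fintype.card_sum, Fintype.card_sigma, Fintype.card_fin, ← Nat.card_eq_fintype_card]
    simp only [Fintype.card_fin]
    omega)
  refine ⟨fun i => Sum.elim (fun a => some a.1) (fun _ => none) (e.symm i), fun w => ?_⟩
  have hinj : Function.Injective fun a : Fin (n w) => e (Sum.inl ⟨w, a⟩) := fun a b hab => by
    simpa using hab
  have : {i | Sum.elim (fun a : Σ w, Fin (n w) => some a.1) (fun _ => none) (e.symm i) = some w} =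
      (fun a : Fin (n w) => e (Sum.inl ⟨w, a⟩)) '' univ := by
    ext i
    obtain ⟨y, rfl⟩ := e.surjective i
    rcases y with ⟨v, a⟩ | a
    · simp only [mem_ofPred_eq, Equiv.symm_apply_apply, Sum.elim_inl, Option.some.injEq,
        image_univ, mem_range, EmbeddingLike.apply_eq_iff_eq, Sum.inl.injEq]
      constructor
      · rintro rfl
        exact ⟨a, rfl⟩
      · rintro ⟨b, hb⟩
        exact (congrArg Sigma.fst hb).symm
    · simp
  rw [this, ncard_image_of_injective _ hinj, ncard_univ, Nat.card_fin]

variable [Nonempty ι]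

/-- The rows are exactly the circuits of size `Nat.card ι`: the others have `Nat.card ι + 1` or four
elements. An isomorphism therefore permutes them and carries membership patterns along. -/
theorem exists_perm_of_isIso (hr : 5 ≤ Nat.card ι) {h h' : ι → Fin k → Bool}
    (hh : IsRichColumnMap h) (hh' : IsRichColumnMap h')
    (hiso : IsIso (spikeMatroid _ hh.isSpikeFamily) (spikeMatroid _ hh'.isSpikeFamily)) :
    ∃ σ : Equiv.Perm (Option (Fin k)), ∀ w : Fin k → Bool, {i | h i = w}.ncard =
      {x | ∀ j, x ∈ rowTransversal h' (σ j) ↔ j.elim false w = true}.ncard := by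
  obtain ⟨f, hf⟩ := hiso
  let φ : ι × Bool ≃ ι × Bool :=
    (Equiv.Set.univ _).symm.trans ((f : (univ : Set (ι × Bool)) ≃ (univ : Set (ι × Bool))).trans
      (Equiv.Set.univ _))
  have hφ : ∀ X : Set (ι × Bool), (spikeMatroid _ hh.isSpikeFamily).IsCircuit X →
      (spikeMatroid _ hh'.isSpikeFamily).IsCircuit (φ '' X) := fun X hX => by
    have h1 := isCircuit_image_iff_of_equiv hf (Subtype.val ⁻¹' X)
    have h2 : (Subtype.val '' (Subtype.val ⁻¹' X :
        Set (spikeMatroid _ hh.isSpikeFamily).E) : Set (ι × Bool)) = X := by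
      simp
    rw [h2] at h1
    have h3 := h1.1 hX
    convert h3 using 1
    ext y
    constructor
    · rintro ⟨x, hx, rfl⟩
      exact ⟨_, ⟨⟨x, mem_univ x⟩, hx, rfl⟩, rfl⟩
    · rintro ⟨_, ⟨⟨x, _⟩, hx, rfl⟩, rfl⟩
      exact ⟨x, hx, rfl⟩
  have key : ∀ j, ∃ j', rowTransversal h' j' = φ '' rowTransversal h j := fun j => by
    have hC := hφ _ ((spikeMatroid_isCircuit_iff (hB := hh.isSpikeFamily) (by omega)).2
      (Or.inl ⟨j, rfl⟩))
    have hcard : (φ '' rowTransversal h j).ncard = Nat.card ι := by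
      rw [ncard_image_of_injective _ φ.injective, (isTransversal_rowTransversal h j).ncard]
    rcases (spikeMatroid_isCircuit_iff (by omega)).1 hC with h1 | ⟨h1, -⟩ | ⟨a, b, hab, h1⟩
    · exact h1
    · omega
    · rw [h1, ncard_two_legs hab] at hcard
      omega
  choose σ hσ using key
  have hinj : Function.Injective σ := fun a b hab => by
    have h1 := (hσ a).symm.trans ((congrArg _ hab).trans (hσ b))
    exact hh.rowTransversal_injective (φ.injective.image_injective h1)
  refine ⟨Equiv.ofBijective σ (Finite.injective_iff_bijective.1 hinj), fun w => ?_⟩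
  rw [ncard_column_fiber, ← ncard_image_of_injective _ φ.injective]
  congr 1
  ext y
  obtain ⟨x, rfl⟩ := φ.surjective y
  simp only [φ.injective.mem_set_image, mem_ofPred_eq, Equiv.ofBijective_apply, hσ]

end ColumnFamily

/-! ### Counting isomorphism classes -/

section Counting

open Set

/-- The non-constant Boolean vectors of length `k`. -/
abbrev NonconstVector (k : ℕ) : Type :=
  {w : Fin k → Bool // w ≠ (fun _ => false) ∧ w ≠ (fun _ => true)}

theorem card_nonconstVector {k : ℕ} (hk : 2 ≤ k) :
    Fintype.card (NonconstVector k) = 2 ^ k - 2 := by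
  have hne : (fun _ => false : Fin k → Bool) ≠ fun _ => true := fun h => by
    simpa using congrFun h ⟨0, by omega⟩
  rw [Fintype.card_subtype]
  have : (Finset.univ.filter fun w : Fin k → Bool => w ≠ (fun _ => false) ∧ w ≠ (fun _ => true)) =
      ({fun _ => false, fun _ => true} : Finset (Fin k → Bool))ᶜ := by
    ext w
    simp
  rw [this, Finset.card_compl, Finset.card_pair hne]
  simp

theorem exists_richColumnMap {ι : Type*} [Finite ι] {k : ℕ} (hk : 2 ≤ k)
    (n : NonconstVector k → ℕ) (hn2 : ∀ w, 2 ≤ n w) (hn : ∑ w, n w ≤ Nat.card ι) :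
    ∃ h : ι → Fin k → Bool, IsRichColumnMap h ∧ ∀ w : NonconstVector k,
      {i | h i = w}.ncard = n w := by
  obtain ⟨F, hF⟩ := exists_map_ncard_fiber n hn
  have hfib : ∀ w : NonconstVector k,
      {i | (F i).elim (fun _ => true) (fun v => v.1) = w.1}.ncard = n w := fun w => by
    rw [← hF w]
    congr 1
    ext i
    simp only [mem_ofPred_eq]
    cases F i with
    | none => simpa using fun h => w.2.2 h.symm
    | some v => simp [Subtype.ext_iff]
  -- Unassigned legs receive the all-ones column: it is nonzero, and being constant it disturbs no
  -- prescribed multiplicity.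
  refine ⟨fun i => (F i).elim (fun _ => true) (fun v => v.1), ⟨fun i => ?_, fun a => ?_⟩, hfib⟩
  · cases F i with
    | none => exact ⟨⟨0, by omega⟩, rfl⟩
    | some v =>
      by_contra hcon
      exact v.2.1 (funext fun a => by simpa using fun h => hcon ⟨a, h⟩)
  · have hne : ∃ b, b ≠ a := by
      have : Nontrivial (Fin k) := Fin.nontrivial_iff_two_le.2 hk
      exact exists_ne a
    have h1 := hfib ⟨fun b => decide (b = a), fun h => by simpa using congrFun h a, fun h => by
      obtain ⟨b, hb⟩ := hne
      exact hb (by simpa using congrFun h b)⟩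
    have h2 := hn2 ⟨fun b => decide (b = a), fun h => by simpa using congrFun h a, fun h => by
      obtain ⟨b, hb⟩ := hne
      exact hb (by simpa using congrFun h b)⟩
    rw [← h1] at h2
    obtain ⟨i, i', hi, hi', hne⟩ := (one_lt_ncard_iff).1 h2
    exact ⟨i, i', hne, hi, hi'⟩

/-- Needed because `ncard` is zero on infinite sets, so comparing counts of isomorphism classes
requires finiteness. -/
instance finite_matroid {α : Type*} [Finite α] : Finite (Matroid α) :=
  Finite.of_injective (fun M : Matroid α => (M.E, M.Indep)) fun _ _ h =>
    Matroid.ext_indep (congrArg Prod.fst h) fun I _ =>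
      iff_of_eq (congrFun (congrArg Prod.snd h) I)

theorem numIsoClasses_mono {n : ℕ} {P Q : Matroid (Fin n) → Prop} (h : ∀ M, P M → Q M) :
    numIsoClasses n P ≤ numIsoClasses n Q :=
  ncard_le_ncard (fun _ ⟨M, hM, hq⟩ => ⟨M, h _ hM, hq⟩) (Set.toFinite _)

theorem pow_le_factorial_mul_numIsoClasses {k t s : ℕ} (hk : 2 ≤ k) (ht : 5 ≤ t)
    (hs : 2 ^ k * (s + 1) ≤ t) :
    s ^ (2 ^ k - 2) ≤ (k + 1).factorial * numIsoClasses (2 * t)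
      (fun M => IsExcludedMinor k M ∧ IsCoveredSpike (k + 1) M) := by
  classical
  have : NeZero t := ⟨by omega⟩
  -- The shift by 2 supplies the repeated unit columns. Each multiplicity is at most `s + 1`, so
  -- they fit into `t` legs.
  have hex : ∀ g : NonconstVector k → Fin s, ∃ h : ZMod t → Fin k → Bool, IsRichColumnMap h ∧
      ∀ w : NonconstVector k, {i | h i = w}.ncard = g w + 2 := fun g => by
    refine exists_richColumnMap hk (fun w => (g w : ℕ) + 2) (fun w => by omega) ?_
    rw [Nat.card_zmod]
    refine le_trans ?_ hs
    refine (Finset.sum_le_card_nsmul _ _ (s + 1) fun w _ => by have := (g w).2; omega).trans ?_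
    rw [Finset.card_univ, card_nonconstVector hk, smul_eq_mul]
    exact Nat.mul_le_mul_right _ (Nat.sub_le _ _)
  choose h hh hfib using hex
  have e : ZMod t × Bool ≃ Fin (2 * t) := Fintype.equivFinOfCardEq (by
    rw [Fintype.card_prod, ZMod.card, Fintype.card_bool, mul_comm])
  let N : (NonconstVector k → Fin s) → {M : Matroid (Fin (2 * t)) // M.E = univ} := fun g =>
    ⟨(spikeMatroid _ (hh g).isSpikeFamily).mapEquiv e, by simp⟩
  let q : (NonconstVector k → Fin s) → Quotient (isoSetoid (2 * t)) := fun g => Quotient.mk _ (N g)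
  have hperm : ∀ g g', q g = q g' → ∃ σ : Equiv.Perm (Option (Fin k)),
      ∀ w : NonconstVector k, (g w : ℕ) + 2 =
        {x | ∀ j, x ∈ rowTransversal (h g') (σ j) ↔ j.elim false w.1 = true}.ncard := by
    intro g g' hq
    have hiso : IsIso (N g).1 (N g').1 := Quotient.exact hq
    obtain ⟨σ, hσ⟩ := exists_perm_of_isIso (by rwa [Nat.card_zmod]) (hh g) (hh g')
      ((isIso_mapEquiv _ e).trans (hiso.trans (isIso_mapEquiv _ e).symm))
    exact ⟨σ, fun w => (hfib g w).symm.trans (hσ w.1)⟩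
  have hcard : Fintype.card (NonconstVector k → Fin s) = s ^ (2 ^ k - 2) := by
    rw [Fintype.card_fun, Fintype.card_fin, card_nonconstVector hk]
  rw [← hcard, ← Finset.card_univ]
  -- On a fibre of `q` the row permutation is an injective label, since it and the fixed `g'`
  -- determine all multiplicities.
  have hle := Finset.card_le_mul_card_image (f := q) Finset.univ (k + 1).factorial (by
    intro b hb
    obtain ⟨g', -, rfl⟩ := Finset.mem_image.1 hb
    have hperm' : ∀ g, ∃ σ : Equiv.Perm (Option (Fin k)), q g = q g' →
        ∀ w : NonconstVector k, (g w : ℕ) + 2 =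
          {x | ∀ j, x ∈ rowTransversal (h g') (σ j) ↔ j.elim false w.1 = true}.ncard := fun g => by
      by_cases hq : q g = q g'
      · obtain ⟨σ, hσ⟩ := hperm g g' hq
        exact ⟨σ, fun _ => hσ⟩
      · exact ⟨1, fun h => absurd h hq⟩
    choose σ hσ using hperm'
    have hc : (Finset.univ : Finset (Equiv.Perm (Option (Fin k)))).card = (k + 1).factorial := by
      rw [Finset.card_univ, Fintype.card_perm, Fintype.card_option, Fintype.card_fin]
    rw [← hc]
    refine Finset.card_le_card_of_injOn σ (fun _ _ => Finset.mem_coe.2 (Finset.mem_univ _)) ?_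
    intro g1 hg1 g2 hg2 heq
    have h1 := hσ g1 (by simpa using hg1)
    have h2 := hσ g2 (by simpa using hg2)
    rw [heq] at h1
    funext w
    have := (h1 w).trans (h2 w).symm
    exact Fin.ext (by omega))
  refine hle.trans (Nat.mul_le_mul_left _ ?_)
  rw [← ncard_coe_finset, numIsoClasses]
  refine ncard_le_ncard ?_ (Set.toFinite _)
  intro b hb
  obtain ⟨g, -, rfl⟩ := Finset.mem_image.1 (Finset.mem_coe.1 hb)
  exact ⟨N g, ⟨(isExcludedMinor_spikeMatroid ht (hh g).encard_range
    (hh g).exists_mem_exists_notMem).mapEquiv e, (isCoveredSpike_spikeMatroid ht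
    (by exact_mod_cast (hh g).encard_range) (hh g).exists_mem_exists_notMem).mapEquiv e⟩, rfl⟩

theorem exists_pos_mul_zpow_le {k : ℕ} (hk : 2 ≤ k) {f : ℕ → ℕ}
    (hf : ∀ t s, 5 ≤ t → 2 ^ k * (s + 1) ≤ t → s ^ (2 ^ k - 2) ≤ (k + 1).factorial * f t) :
    ∃ c : ℝ, 0 < c ∧ ∃ T : ℕ, ∀ t : ℕ, T ≤ t →
      c * (t : ℝ) ^ ((2 : ℤ) ^ k - (k : ℤ) - 3) ≤ (f t : ℝ) := by
  have hpow : 2 ^ 2 ≤ 2 ^ k := Nat.pow_le_pow_right (by norm_num) hk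
  -- With `s = ⌊t / 2^(k+1)⌋`, the threshold `t ≥ 2^(k+2)` gives both `2^k (s + 1) ≤ t` and `t ≤
  -- 2^(k+2) s`; the second inequality produces the constant.
  refine ⟨(((k + 1).factorial : ℝ) * ((2 : ℝ) ^ (k + 2)) ^ (2 ^ k - 2))⁻¹, by positivity,
    2 ^ (k + 2), fun t ht => ?_⟩
  obtain ⟨s, hs⟩ : ∃ s, s = t / 2 ^ (k + 1) := ⟨_, rfl⟩
  have h1 : 2 ^ (k + 1) * s ≤ t := hs ▸ Nat.mul_div_le t _
  have h2 : t < 2 ^ (k + 1) * (s + 1) := hs ▸ Nat.lt_mul_div_succ t (by positivity)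
  have e1 : 2 ^ (k + 1) = 2 * 2 ^ k := pow_succ' 2 k
  have e2 : 2 ^ (k + 2) = 4 * 2 ^ k := by ring
  have h3 := hf t s (by omega) (by
    rw [e1] at h1
    rw [e2] at ht
    nlinarith)
  have h4 : t ≤ 2 ^ (k + 2) * s := by
    have hs1 : 1 ≤ s := by
      by_contra hcon
      have : s = 0 := by omega
      subst this
      omega
    rw [e1] at h2
    rw [e2]
    nlinarith
  have h3' : (s : ℝ) ^ (2 ^ k - 2) ≤ (k + 1).factorial * (f t : ℝ) := by exact_mod_cast h3
  have h4' : (t : ℝ) ≤ 2 ^ (k + 2) * s := by exact_mod_cast h4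
  have ht1 : (1 : ℝ) ≤ t := by
    have : 1 ≤ t := by omega
    exact_mod_cast this
  -- The target exponent is an integer that equals `-1` when `k = 2`; since `t ≥ 1`, it suffices
  -- that it is at most `2^k - 2`.
  have h5 : (t : ℝ) ^ ((2 : ℤ) ^ k - (k : ℤ) - 3) ≤ (t : ℝ) ^ (2 ^ k - 2) := by
    rw [← zpow_natCast]
    refine zpow_le_zpow_right₀ ht1 ?_
    rw [Nat.cast_sub (by omega)]
    push_cast
    omega
  rw [inv_mul_le_iff₀ (by positivity)]
  calc (t : ℝ) ^ ((2 : ℤ) ^ k - (k : ℤ) - 3) ≤ (t : ℝ) ^ (2 ^ k - 2) := h5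
    _ ≤ (2 ^ (k + 2) * s) ^ (2 ^ k - 2) := by gcongr
    _ = (2 ^ (k + 2)) ^ (2 ^ k - 2) * (s : ℝ) ^ (2 ^ k - 2) := mul_pow _ _ _
    _ ≤ (2 ^ (k + 2)) ^ (2 ^ k - 2) * ((k + 1).factorial * (f t : ℝ)) := by gcongr
    _ = _ := by ring

end Counting

end Spikes

theorem lemma3p12 (k : ℕ) (hk : 2 ≤ k) :
    ∃ c : ℝ, 0 < c ∧ ∃ T : ℕ, ∀ t : ℕ, T ≤ t →
      c * (t : ℝ) ^ ((2 : ℤ) ^ k - (k : ℤ) - 3) ≤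
          (Spikes.numIsoClasses (2 * t) (fun M => Spikes.IsExcludedMinor k M) : ℝ) ∧
      c * (t : ℝ) ^ ((2 : ℤ) ^ k - (k : ℤ) - 3) ≤
          (Spikes.numIsoClasses (2 * t)
            (fun M => Spikes.IsExcludedMinor k M ∧ Spikes.IsCoveredSpike (k + 1) M) : ℝ) := by
  obtain ⟨c, hc, T, hT⟩ := Spikes.exists_pos_mul_zpow_le hk
    (fun t s ht hs => Spikes.pow_le_factorial_mul_numIsoClasses hk ht hs)
  refine ⟨c, hc, T, fun t ht => ⟨(hT t ht).trans ?_, hT t ht⟩⟩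
  exact_mod_cast Spikes.numIsoClasses_mono (n := 2 * t)
    (P := fun M => Spikes.IsExcludedMinor k M ∧ Spikes.IsCoveredSpike (k + 1) M) fun _ hM => hM.1
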